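/- A $d$-dimensional VASS-MDP is a tuple $S=\langle Q,Q_1,Q_P,T,\tau\rangle$, where $Q$ is a finite set of control states partitioned into the states $Q_1$ of Player 1 and the probabilistic states $Q_P$, $T\subseteq Q\times\mathbb Z^d\times Q$ is a finite set of transitions, and $\tau$ assigns to each transition a positive integer weight. A configuration is a pair $\langle q,\mathbf v\rangle\in Q\times\mathbb N^d$. A transition $\langle q,\mathbf z,q'\rangle$ is enabled in $\langle q,\mathbf v\rangle$ if $\mathbf v+\mathbf z\ge \mathbf 0$, and it then leads to $\langle q',\mathbf v+\mathbf z\rangle$. If $q\in Q_1$, Player 1 chooses the successor by means of a strategy, that is, a function of the finite play so far; if $q\in Q_P$, an enabled transition is drawn at random with probability proportional to its weight. $S$ is deadlock-free if every configuration has an enabled transition, and it is a P-VASS-MDP if $\mathbf z=\mathbf 0$ for every transition $\langle q,\mathbf z,q'\rangle\in T$ with $q\in Q_1$. A strategy $\sigma$ and an initial configuration $c_0$ induce a probability measure $\mathbb P_{c_0}^{\sigma}$ on infinite plays. Given $S$, an initial configuration $c_0$ and a control state $q_F$, let $E$ be the event that $q_F$ is visited at least once (reachability) or infinitely often (repeated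 reachability). The almost-sure problem for $E$ asks whether there is a strategy $\sigma$ with $\mathbb P_{c_0}^{\sigma}(E)=1$; the limit-sure problem asks whether $\sup_\sigma \mathbb P_{c_0}^{\sigma}(E)=1$. **Theorem.** The almost-sure reachability problem, the limit-sure reachability problem, the almost-sure repeated reachability problem and the limit-sure repeated reachability problem are all undecidable for 2-dimensional deadlock-free P-VASS-MDPs. -/

import Mathlib

open MeasureTheory ProbabilityTheory
open scoped ENNReal

noncomputable section

namespace VASS

/-- A transition `(src, vec, tgt) ∈ Q × ℤ^d × Q` of a `d`-dimensional VASS. -/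
@[ext]
structure Transition (Q : Type) (d : ℕ) where
  src : Q
  vec : Fin d → ℤ
  tgt : Q

/-- A configuration: a control state together with a vector of natural numbers. -/
@[ext]
structure Config (Q : Type) (d : ℕ) where
  state : Q
  val : Fin d → ℕ

/-- The set of configurations is a discrete space. -/
instance (Q : Type) (d : ℕ) : MeasurableSpace (Config Q d) := ⊤

instance (Q : Type) (d : ℕ) : DiscreteMeasurableSpace (Config Q d) := ⟨fun _ => trivial⟩

instance (Q : Type) (d : ℕ) [Finite Q] : Countable (Config Q d) :=
  Function.Injective.countable (f := fun c : Config Q d => (c.state, c.val)) (by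
    rintro ⟨q, v⟩ ⟨q', v'⟩ h
    simpa using h)

/-- `t` is enabled in `c`: it leaves the control state of `c`, and no counter becomes negative. -/
def Transition.Enabled {Q : Type} {d : ℕ} (t : Transition Q d) (c : Config Q d) : Prop :=
  t.src = c.state ∧ ∀ i, 0 ≤ (c.val i : ℤ) + t.vec i

/-- The configuration reached by firing `t` in `c` (meaningful when `t` is enabled in `c`). -/
def Transition.fire {Q : Type} {d : ℕ} (t : Transition Q d) (c : Config Q d) : Config Q d where
  state := t.tgt
  val i := ((c.val i : ℤ) + t.vec i).toNat

end VASS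

open VASS

/-- A `d`-dimensional VASS-MDP with control states `Q` (used for finite `Q`). The control states are
partitioned into those of Player 1, `Q₁`, and the probabilistic ones, `Q_P = Q \ Q₁`; there are
finitely many transitions, and each carries a positive integer weight
(values of `weight` outside `T` play no role). -/
structure VASSMDP (Q : Type) (d : ℕ) where
  Q₁ : Finset Q
  T : Finset (Transition Q d)
  weight : Transition Q d → ℕ
  weight_pos : ∀ t ∈ T, 0 < weight t

namespace VASSMDP

variable {Q : Type} {d : ℕ}

/-- The transition relation of the induced MDP. -/
def Step (S : VASSMDP Q d) (c c' : Config Q d) : Prop :=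
  ∃ t ∈ S.T, t.Enabled c ∧ c' = t.fire c

/-- Every configuration has a successor. -/
def DeadlockFree (S : VASSMDP Q d) : Prop :=
  ∀ c : Config Q d, ∃ c', S.Step c c'

/-- P-VASS-MDP: no transition leaving a state of Player 1 changes the counters. -/
def IsPVASS (S : VASSMDP Q d) : Prop :=
  ∀ t ∈ S.T, t.src ∈ S.Q₁ → t.vec = 0

open Classical in
/-- The weight of `t` if `t` is a transition of `S` enabled in `c`, and `0` otherwise. -/
def enabledWeight (S : VASSMDP Q d) (c : Config Q d) (t : Transition Q d) : ℝ≥0∞ :=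
  if t ∈ S.T ∧ t.Enabled c then (S.weight t : ℝ≥0∞) else 0

theorem tsum_enabledWeight (S : VASSMDP Q d) (c : Config Q d) :
    ∑' t, S.enabledWeight c t = ∑ t ∈ S.T, S.enabledWeight c t :=
  tsum_eq_sum fun t ht => by simp [enabledWeight, ht]

theorem tsum_enabledWeight_ne_top (S : VASSMDP Q d) (c : Config Q d) :
    ∑' t, S.enabledWeight c t ≠ ∞ := by
  rw [tsum_enabledWeight]
  refine ENNReal.sum_ne_top.2 fun t _ => ?_
  unfold enabledWeight
  split_ifs <;> simp

theorem tsum_enabledWeight_ne_zero (S : VASSMDP Q d) (hS : S.DeadlockFree) (c : Config Q d) :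
    ∑' t, S.enabledWeight c t ≠ 0 := by
  obtain ⟨_, t, ht, hen, _⟩ := hS c
  intro h
  have h0 := ENNReal.tsum_eq_zero.1 h t
  rw [enabledWeight, if_pos ⟨ht, hen⟩] at h0
  exact (S.weight_pos t ht).ne' (by exact_mod_cast h0)

/-- The successor distribution of the induced MDP at a probabilistic configuration `c`: an enabled
transition is drawn with probability its weight divided by the sum of the weights of all enabled
transitions, and is then fired. -/
def succDist (S : VASSMDP Q d) (hS : S.DeadlockFree) (c : Config Q d) : PMF (Config Q d) :=
  (PMF.normalize (S.enabledWeight c) (S.tsum_enabledWeight_ne_zero hS c)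
    (S.tsum_enabledWeight_ne_top c)).map fun t => t.fire c

/-- A sequence `c₀, …, cₙ` of configurations. -/
abbrev History (Q : Type) (d n : ℕ) : Type :=
  (i : Finset.Iic n) → Config Q d

/-- The last configuration `cₙ` of a history. -/
def History.last {n : ℕ} (h : History Q d n) : Config Q d :=
  h ⟨n, Finset.mem_Iic.2 le_rfl⟩

/-- A (deterministic, history dependent) strategy of Player 1: after a finite play that ends in a
configuration of Player 1 it picks a successor of that configuration. Its values on sequences
that are not plays, or that end in a probabilistic configuration, play no role. -/
structure Strategy (S : VASSMDP Q d) where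
  move : (n : ℕ) → History Q d n → Config Q d
  move_step : ∀ (n : ℕ) (h : History Q d n), h.last.state ∈ S.Q₁ →
    (∃ c', S.Step h.last c') → S.Step h.last (move n h)

variable [Finite Q]

open Classical in
/-- The law of the next configuration, given the history, under the strategy `σ`. -/
def stepKernel (S : VASSMDP Q d) (hS : S.DeadlockFree) (σ : S.Strategy) (n : ℕ) :
    Kernel (History Q d n) (Config Q d) :=
  Kernel.ofFunOfCountable fun h =>
    if h.last.state ∈ S.Q₁ then Measure.dirac (σ.move n h)
    else (S.succDist hS h.last).toMeasure

instance (S : VASSMDP Q d) (hS : S.DeadlockFree) (σ : S.Strategy) (n : ℕ) :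
    IsMarkovKernel (S.stepKernel hS σ n) := by
  classical
  refine ⟨fun h => ?_⟩
  change IsProbabilityMeasure
    (if h.last.state ∈ S.Q₁ then Measure.dirac (σ.move n h) else (S.succDist hS h.last).toMeasure)
  split_ifs <;> infer_instance

/-- The probability measure on infinite sequences of configurations (starting at `c₀`) that is
induced by the strategy `σ`, given by the Ionescu-Tulcea theorem. -/
def playMeasure (S : VASSMDP Q d) (hS : S.DeadlockFree) (σ : S.Strategy) (c₀ : Config Q d) :
    Measure (ℕ → Config Q d) :=
  Kernel.traj (X := fun _ => Config Q d) (S.stepKernel hS σ) 0 fun _ => c₀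

end VASSMDP

/-- The sequences that visit the control state `q`. -/
def reachEvent {Q : Type} {d : ℕ} (q : Q) : Set (ℕ → Config Q d) :=
  {ω | ∃ n, (ω n).state = q}

/-- The sequences that visit the control state `q` infinitely often. -/
def repeatedReachEvent {Q : Type} {d : ℕ} (q : Q) : Set (ℕ → Config Q d) :=
  {ω | ∀ N, ∃ n ≥ N, (ω n).state = q}

/-- An input of the (repeated) reachability problems for `d`-dimensional deadlock-free
P-VASS-MDPs: such a system (its control states numbered `0, …, numStates - 1`), an initial
configuration and a target control state. -/
structure PInstance (d : ℕ) where
  numStates : ℕ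
  sys : VASSMDP (Fin numStates) d
  deadlockFree : sys.DeadlockFree
  isPVASS : sys.IsPVASS
  init : Config (Fin numStates) d
  target : Fin numStates

namespace PInstance

variable {d : ℕ}

/-- The probability of an event when Player 1 uses `σ` from the initial configuration. -/
def prob (I : PInstance d) (σ : I.sys.Strategy) (E : Set (ℕ → Config (Fin I.numStates) d)) :
    ℝ≥0∞ :=
  I.sys.playMeasure I.deadlockFree σ I.init E

def AlmostSureReach (I : PInstance d) : Prop :=
  ∃ σ : I.sys.Strategy, I.prob σ (reachEvent I.target) = 1

def LimitSureReach (I : PInstance d) : Prop :=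
  (⨆ σ : I.sys.Strategy, I.prob σ (reachEvent I.target)) = 1

def AlmostSureRepeatedReach (I : PInstance d) : Prop :=
  ∃ σ : I.sys.Strategy, I.prob σ (repeatedReachEvent I.target) = 1

def LimitSureRepeatedReach (I : PInstance d) : Prop :=
  (⨆ σ : I.sys.Strategy, I.prob σ (repeatedReachEvent I.target)) = 1

/-- Finite descriptions of inputs: for each control state whether it belongs to Player 1; the
list of transitions as (source, vector, target, weight); the initial state and vector; the target
state. -/
abbrev Code : Type :=
  List Bool × List (ℕ × List ℤ × ℕ × ℕ) × (ℕ × List ℕ) × ℕ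

/-- The code of a transition and its weight. -/
def transitionCode (I : PInstance d) (t : Transition (Fin I.numStates) d) :
    ℕ × List ℤ × ℕ × ℕ :=
  (t.src, List.ofFn t.vec, t.tgt, I.sys.weight t)

/-- `w` describes `I`; the transitions may be listed in any order, without repetitions. -/
structure IsCode (I : PInstance d) (w : Code) : Prop where
  states : w.1 = List.ofFn fun q => decide (q ∈ I.sys.Q₁)
  nodup : w.2.1.Nodup
  transitions : ∀ e, e ∈ w.2.1 ↔ ∃ t ∈ I.sys.T, e = I.transitionCode t
  init : w.2.2.1 = ((I.init.state : ℕ), List.ofFn I.init.val)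
  target : w.2.2.2 = (I.target : ℕ)

end PInstance

/-- A property of inputs is decidable if some computable function on descriptions answers
correctly on every description of every input. -/
def DecidableProblem {d : ℕ} (P : PInstance d → Prop) : Prop :=
  ∃ f : PInstance.Code → Bool, Computable f ∧
    ∀ (I : PInstance d) (w : PInstance.Code), I.IsCode w → (f w = true ↔ P I)

end

/-!
Every partial recursive function is computed by a residue machine, which acts on a single number
(registers being the exponents of primes) by branching on its residue and replacing it by an affine
function of the quotient. A P-VASS-MDP with two counters simulates one step: it drains the counter
that holds the number while the other accumulates the next one. Counters cannot be tested for zero,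
so Player 1 announces that the quotient is exhausted and what the remainder is, and a random check
catches a false announcement with probability at least `1 / 2`. If the computation reaches the
accepting state, the honest strategy reaches it with probability `1` and stays there forever; if it
reaches the sink, every strategy accepts with probability at most `1 / 2`. A decision procedure for
any of the four problems would therefore separate the codes `n` with `φ_n(n) = 1` from those with
`φ_n(n) = 0`, which are recursively inseparable.
-/

open VASS

namespace VASSMDP

variable {Q : Type} {d : ℕ}

theorem measurableSet_state_eq (n : ℕ) (q : Q) :
    MeasurableSet {ω : ℕ → Config Q d | (ω n).state = q} :=
  measurable_pi_apply (X := fun _ => Config Q d) n (t := {c | c.state = q}) trivial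

theorem repeatedReachEvent_subset_reachEvent (q : Q) :
    repeatedReachEvent (d := d) q ⊆ reachEvent q := fun _ h =>
  let ⟨n, _, hn⟩ := h 0
  ⟨n, hn⟩

section Superharmonic

/-- `V` does not increase under the moves of Player 1, and does not increase in expectation under
the random moves. Such a `V` bounds the probability of reaching a set on which it is at least `1`,
whatever Player 1 does. -/
structure IsSuperharmonic (S : VASSMDP Q d) (hS : S.DeadlockFree) (V : Config Q d → ℝ≥0∞) :
    Prop where
  le_of_step : ∀ c c', c.state ∈ S.Q₁ → S.Step c c' → V c' ≤ V c
  lintegral_le : ∀ c, c.state ∉ S.Q₁ → ∫⁻ y, V y ∂(S.succDist hS c).toMeasure ≤ V c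

open Classical in
/-- The process `V (ω n)`, frozen at the value `1` from the first visit to `q` on. -/
noncomputable def stoppedProcess (V : Config Q d → ℝ≥0∞) (q : Q) (n : ℕ) (ω : ℕ → Config Q d) :
    ℝ≥0∞ :=
  if ∃ k ≤ n, (ω k).state = q then 1 else V (ω n)

theorem stoppedProcess_succ_le {V : Config Q d → ℝ≥0∞} {q : Q} (hq : ∀ c, c.state = q → 1 ≤ V c)
    {n : ℕ} {ω : ℕ → Config Q d} (h : ¬ ∃ k ≤ n, (ω k).state = q) :
    stoppedProcess V q (n + 1) ω ≤ V (ω (n + 1)) := by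
  unfold stoppedProcess
  split_ifs with h'
  · obtain ⟨k, hk, hkq⟩ := h'
    obtain rfl : k = n + 1 := by
      by_contra hne
      exact h ⟨k, by omega, hkq⟩
    exact hq _ hkq
  · exact le_rfl

end Superharmonic

section PlayMeasure

variable [Finite Q] (S : VASSMDP Q d) (hS : S.DeadlockFree) (σ : S.Strategy) (c₀ : Config Q d)

instance : IsProbabilityMeasure (S.playMeasure hS σ c₀) := by
  unfold playMeasure; infer_instance

theorem lintegral_playMeasure_zero (f : Config Q d → ℝ≥0∞) :
    ∫⁻ ω, f (ω 0) ∂S.playMeasure hS σ c₀ = f c₀ := by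
  have hmap := Kernel.traj_map_frestrictLe_apply (X := fun _ => Config Q d)
    (κ := S.stepKernel hS σ) 0 0 (fun _ => c₀)
  calc ∫⁻ ω, f (ω 0) ∂S.playMeasure hS σ c₀
      = ∫⁻ x : History Q d 0, f x.last
          ∂(S.playMeasure hS σ c₀).map (Preorder.frestrictLe 0) := by
        rw [lintegral_map (measurable_of_countable _) (Preorder.measurable_frestrictLe 0)]
        rfl
    _ = f c₀ := by
        rw [playMeasure, hmap]
        simp [Kernel.id_apply, lintegral_dirac, History.last]

theorem lintegral_playMeasure_succ (n : ℕ) (f : History Q d n → Config Q d → ℝ≥0∞) :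
    ∫⁻ ω, f (Preorder.frestrictLe n ω) (ω (n + 1)) ∂S.playMeasure hS σ c₀ =
      ∫⁻ ω, ∫⁻ y, f (Preorder.frestrictLe n ω) y
        ∂(S.stepKernel hS σ n (Preorder.frestrictLe n ω)) ∂S.playMeasure hS σ c₀ := by
  have hjoint := Kernel.partialTraj_compProd_eq_map_traj (X := fun _ => Config Q d)
    (κ := S.stepKernel hS σ) (Nat.zero_le n) (x₀ := fun _ => c₀)
  have hmap := Kernel.traj_map_frestrictLe_apply (X := fun _ => Config Q d)
    (κ := S.stepKernel hS σ) 0 n (fun _ => c₀)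
  have hf : Measurable (Function.uncurry f) := measurable_of_countable _
  calc _ = ∫⁻ z, Function.uncurry f z ∂((S.playMeasure hS σ c₀).map
        fun x => (Preorder.frestrictLe n x, x (n + 1))) := by
        rw [lintegral_map hf (by fun_prop)]; rfl
    _ = _ := by
        rw [playMeasure, ← hjoint, Measure.lintegral_compProd hf, ← hmap,
          lintegral_map (measurable_of_countable _) (Preorder.measurable_frestrictLe n)]
        rfl

open Classical in
theorem lintegral_stepKernel (n : ℕ) (h : History Q d n) (f : Config Q d → ℝ≥0∞) :
    ∫⁻ y, f y ∂S.stepKernel hS σ n h =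
      if h.last.state ∈ S.Q₁ then f (σ.move n h)
      else ∫⁻ y, f y ∂(S.succDist hS h.last).toMeasure := by
  change ∫⁻ y, f y ∂(if _ then _ else _) = _
  split_ifs
  exacts [lintegral_dirac _ _, rfl]

variable {S hS}

theorem IsSuperharmonic.lintegral_stepKernel_le {V : Config Q d → ℝ≥0∞}
    (hV : S.IsSuperharmonic hS V) (n : ℕ) (h : History Q d n) :
    ∫⁻ y, V y ∂S.stepKernel hS σ n h ≤ V h.last := by
  rw [lintegral_stepKernel]
  split_ifs with h₁
  exacts [hV.le_of_step _ _ h₁ (σ.move_step n h h₁ (hS _)), hV.lintegral_le _ h₁]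

theorem IsSuperharmonic.lintegral_stoppedProcess_succ_le {V : Config Q d → ℝ≥0∞}
    (hV : S.IsSuperharmonic hS V) {q : Q} (hq : ∀ c, c.state = q → 1 ≤ V c) (n : ℕ) :
    ∫⁻ ω, stoppedProcess V q (n + 1) ω ∂S.playMeasure hS σ c₀ ≤
      ∫⁻ ω, stoppedProcess V q n ω ∂S.playMeasure hS σ c₀ := by
  classical
  let f : History Q d n → Config Q d → ℝ≥0∞ := fun h y =>
    if ∃ k, (h k).state = q then 1 else V y
  have visited_iff (ω : ℕ → Config Q d) :
      (∃ k, ((Preorder.frestrictLe n ω : History Q d n) k).state = q) ↔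
        ∃ k ≤ n, (ω k).state = q := by simp
  calc ∫⁻ ω, stoppedProcess V q (n + 1) ω ∂S.playMeasure hS σ c₀
      ≤ ∫⁻ ω, f (Preorder.frestrictLe n ω) (ω (n + 1)) ∂S.playMeasure hS σ c₀ := by
        refine lintegral_mono fun ω => ?_
        simp only [f, visited_iff]
        split_ifs with h
        · obtain ⟨k, hk, hkq⟩ := h
          exact (if_pos ⟨k, hk.trans n.le_succ, hkq⟩).le
        · exact stoppedProcess_succ_le hq h
    _ = ∫⁻ ω, ∫⁻ y, f (Preorder.frestrictLe n ω) y
          ∂(S.stepKernel hS σ n (Preorder.frestrictLe n ω)) ∂S.playMeasure hS σ c₀ :=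
        S.lintegral_playMeasure_succ hS σ c₀ n f
    _ ≤ ∫⁻ ω, stoppedProcess V q n ω ∂S.playMeasure hS σ c₀ := by
        refine lintegral_mono fun ω => ?_
        simp only [f, visited_iff, stoppedProcess]
        split_ifs
        exacts [by simp, hV.lintegral_stepKernel_le σ n _]

theorem IsSuperharmonic.lintegral_stoppedProcess_le {V : Config Q d → ℝ≥0∞}
    (hV : S.IsSuperharmonic hS V) {q : Q} (hq : ∀ c, c.state = q → 1 ≤ V c) (n : ℕ) :
    ∫⁻ ω, stoppedProcess V q n ω ∂S.playMeasure hS σ c₀ ≤ V c₀ := by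
  induction n with
  | zero =>
    rw [← S.lintegral_playMeasure_zero hS σ c₀ V]
    refine lintegral_mono fun ω => ?_
    simp only [stoppedProcess]
    split_ifs with h
    · obtain ⟨k, hk, hkq⟩ := h
      rw [Nat.le_zero.1 hk] at hkq
      exact hq _ hkq
    · exact le_rfl
  | succ n ih => exact (hV.lintegral_stoppedProcess_succ_le σ c₀ hq n).trans ih

theorem IsSuperharmonic.playMeasure_reachEvent_le {V : Config Q d → ℝ≥0∞}
    (hV : S.IsSuperharmonic hS V) {q : Q} (hq : ∀ c, c.state = q → 1 ≤ V c) :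
    S.playMeasure hS σ c₀ (reachEvent q) ≤ V c₀ := by
  have hreach : reachEvent (d := d) q = ⋃ n, {ω | (ω n).state = q} := by
    ext; simp [reachEvent]
  rw [hreach, measure_iUnion_eq_iSup_accumulate]
  refine iSup_le fun n => le_trans ?_ (hV.lintegral_stoppedProcess_le σ c₀ hq n)
  have hmeas : MeasurableSet (Set.accumulate (fun n => {ω : ℕ → Config Q d | (ω n).state = q}) n) :=
    MeasurableSet.biUnion (Set.to_countable _) fun k _ => measurableSet_state_eq k q
  rw [← lintegral_indicator_one hmeas]
  refine lintegral_mono fun ω => Set.indicator_le (fun ω hω => ?_) ω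
  rw [Set.mem_accumulate] at hω
  exact (if_pos hω).ge

variable (S hS)

theorem playMeasure_repeatedReachEvent_eq_one (q : Q)
    (h : ∀ N, ⨆ n, S.playMeasure hS σ c₀ {ω | (ω (N + n)).state = q} = 1) :
    S.playMeasure hS σ c₀ (repeatedReachEvent q) = 1 := by
  have hrepeated : repeatedReachEvent q =
      ⋂ N, ⋃ n, {ω : ℕ → Config Q d | (ω (N + n)).state = q} := by
    ext ω
    simp only [repeatedReachEvent, Set.mem_ofPred_eq, Set.mem_iInter, Set.mem_iUnion]
    exact forall_congr' fun N => ⟨fun ⟨n, hn, hq⟩ => ⟨n - N, by rwa [Nat.add_sub_cancel' hn]⟩,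
      fun ⟨n, hn⟩ => ⟨N + n, Nat.le_add_right _ _, hn⟩⟩
  have hmeas (N : ℕ) : MeasurableSet (⋃ n, {ω : ℕ → Config Q d | (ω (N + n)).state = q}) :=
    .iUnion fun n => measurableSet_state_eq _ q
  rw [hrepeated, ← prob_compl_eq_zero_iff (.iInter hmeas), Set.compl_iInter,
    measure_iUnion_null_iff]
  intro N
  rw [prob_compl_eq_zero_iff (hmeas N)]
  exact le_antisymm prob_le_one ((h N).ge.trans (iSup_le fun n =>
    measure_mono (Set.subset_iUnion
      (fun n => {ω : ℕ → Config Q d | (ω (N + n)).state = q}) n)))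

end PlayMeasure

section Positional

variable (S : VASSMDP Q d)

/-- The memoryless strategy that moves from `c` to `m c`. -/
def positional (m : Config Q d → Config Q d) (hm : ∀ c, c.state ∈ S.Q₁ → S.Step c (m c)) :
    S.Strategy where
  move _ h := m h.last
  move_step _ _ h _ := hm _ h

variable (hS : S.DeadlockFree) (m : Config Q d → Config Q d)

open Classical in
/-- The expectation of `g` after one step from `c`, when Player 1 moves according to `m`. -/
noncomputable def expectNext (g : Config Q d → ℝ≥0∞) (c : Config Q d) : ℝ≥0∞ :=
  if c.state ∈ S.Q₁ then g (m c) else ∫⁻ y, g y ∂(S.succDist hS c).toMeasure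

/-- The probability, as a function of the initial configuration, that the control state after `n`
steps is `q`, when Player 1 moves according to `m`. -/
noncomputable def visitProb (q : Q) (n : ℕ) : Config Q d → ℝ≥0∞ :=
  (S.expectNext hS m)^[n] ({c | c.state = q}.indicator 1)

theorem expectNext_mono : Monotone (S.expectNext hS m) := by
  intro f g h c
  unfold expectNext
  split_ifs
  exacts [h _, lintegral_mono h]

theorem visitProb_zero_of_state_eq {q : Q} {c : Config Q d} (hc : c.state = q) :
    S.visitProb hS m q 0 c = 1 :=
  Set.indicator_of_mem (s := {c : Config Q d | c.state = q}) hc _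

theorem visitProb_succ (q : Q) (n : ℕ) :
    S.visitProb hS m q (n + 1) = S.expectNext hS m (S.visitProb hS m q n) :=
  Function.iterate_succ_apply' _ _ _

variable {S hS m}

theorem monotone_visitProb {q : Q} (hq : S.visitProb hS m q 0 ≤ S.visitProb hS m q 1) :
    Monotone (S.visitProb hS m q) :=
  (S.expectNext_mono hS m).monotone_iterate_of_le_map hq

variable [Finite Q]

theorem expectNext_iSup_visitProb {q : Q}
    (hq : S.visitProb hS m q 0 ≤ S.visitProb hS m q 1) :
    S.expectNext hS m (⨆ n, S.visitProb hS m q n) = ⨆ n, S.visitProb hS m q n := by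
  have hmono := monotone_visitProb hq
  calc S.expectNext hS m (⨆ n, S.visitProb hS m q n)
      = ⨆ n, S.visitProb hS m q (n + 1) := by
        ext c
        simp only [visitProb_succ, expectNext, iSup_apply]
        split_ifs
        · rfl
        · exact lintegral_iSup (fun n => measurable_of_countable _) fun a b h => hmono h
    _ = ⨆ n, S.visitProb hS m q n := hmono.iSup_nat_add 1

variable {hm : ∀ c, c.state ∈ S.Q₁ → S.Step c (m c)} {c₀ : Config Q d}

theorem lintegral_playMeasure_positional (n : ℕ) (g : Config Q d → ℝ≥0∞) :
    ∫⁻ ω, g (ω n) ∂S.playMeasure hS (S.positional m hm) c₀ = (S.expectNext hS m)^[n] g c₀ := by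
  induction n generalizing g with
  | zero => exact S.lintegral_playMeasure_zero hS _ c₀ g
  | succ n ih =>
    rw [S.lintegral_playMeasure_succ hS _ c₀ n fun _ y => g y, Function.iterate_succ_apply, ← ih]
    exact lintegral_congr fun ω => S.lintegral_stepKernel hS _ n _ g

theorem playMeasure_positional_state_eq (q : Q) (n : ℕ) :
    S.playMeasure hS (S.positional m hm) c₀ {ω | (ω n).state = q} = S.visitProb hS m q n c₀ := by
  rw [visitProb, ← lintegral_playMeasure_positional (hm := hm),
    ← lintegral_indicator_one (measurableSet_state_eq n q)]
  rfl

theorem playMeasure_positional_repeatedReachEvent_eq_one {q : Q}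
    (hq : S.visitProb hS m q 0 ≤ S.visitProb hS m q 1)
    (h : ⨆ n, S.visitProb hS m q n c₀ = 1) :
    S.playMeasure hS (S.positional m hm) c₀ (repeatedReachEvent q) = 1 := by
  refine S.playMeasure_repeatedReachEvent_eq_one hS _ c₀ q fun N => ?_
  have hmono : Monotone fun n => S.visitProb hS m q n c₀ := fun a b hab =>
    monotone_visitProb hq hab c₀
  simp only [playMeasure_positional_state_eq, add_comm N]
  exact (hmono.iSup_nat_add N).trans h

end Positional

section SuccDist

variable [Finite Q] (S : VASSMDP Q d) (hS : S.DeadlockFree) {c : Config Q d}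

theorem lintegral_succDist (g : Config Q d → ℝ≥0∞) :
    ∫⁻ y, g y ∂(S.succDist hS c).toMeasure =
      (∑' t, S.enabledWeight c t * g (t.fire c)) / ∑' t, S.enabledWeight c t := by
  classical
  rw [lintegral_countable', div_eq_mul_inv]
  simp only [PMF.toMeasure_apply_singleton _ _ (measurableSet_singleton _), succDist,
    PMF.map_apply, PMF.normalize_apply, ← ENNReal.tsum_mul_left, ← ENNReal.tsum_mul_right]
  rw [ENNReal.tsum_comm]
  refine tsum_congr fun t => ?_
  rw [tsum_eq_single (t.fire c) fun b hb => by simp [hb], if_pos rfl]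
  ring

theorem lintegral_succDist_le {g : Config Q d → ℝ≥0∞} {b : ℝ≥0∞}
    (hg : ∀ c', S.Step c c' → g c' ≤ b) : ∫⁻ y, g y ∂(S.succDist hS c).toMeasure ≤ b := by
  rw [lintegral_succDist]
  refine ENNReal.div_le_of_le_mul ?_
  rw [mul_comm, ← ENNReal.tsum_mul_right]
  refine ENNReal.tsum_le_tsum fun t => ?_
  by_cases ht : t ∈ S.T ∧ t.Enabled c
  · gcongr
    exact hg _ ⟨t, ht.1, ht.2, rfl⟩
  · simp [enabledWeight, ht]

theorem lintegral_succDist_of_weight_eq_one (hw : ∀ t ∈ S.T, S.weight t = 1)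
    {E : Finset (Transition Q d)} (hE : ∀ t, t ∈ E ↔ t ∈ S.T ∧ t.Enabled c)
    (g : Config Q d → ℝ≥0∞) :
    ∫⁻ y, g y ∂(S.succDist hS c).toMeasure = (∑ t ∈ E, g (t.fire c)) / E.card := by
  have hone : ∀ t ∈ E, S.enabledWeight c t = 1 := fun t ht => by
    have hen := (hE t).1 ht
    simp [enabledWeight, hen.1, hen.2, hw]
  have hzero : ∀ t ∉ E, S.enabledWeight c t = 0 := fun t ht =>
    if_neg fun hen => ht ((hE t).2 hen)
  rw [lintegral_succDist, tsum_eq_sum (s := E) fun t ht => by rw [hzero t ht, zero_mul],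
    tsum_eq_sum hzero, Finset.sum_congr rfl fun t ht => by rw [hone t ht, one_mul],
    Finset.sum_congr rfl hone, Finset.sum_const, nsmul_one]

end SuccDist

end VASSMDP

/-- A deadlock-free P-VASS-MDP all of whose weights are `1`, presented as a graph on a type of
control states: `out q` lists the vectors and targets of the transitions leaving `q`. -/
structure UnitPVASS (C : Type) (d : ℕ) where
  player : Set C
  out : C → Set ((Fin d → ℤ) × C)
  finite_out : ∀ q, (out q).Finite
  exists_zero_mem_out : ∀ q, ∃ q', (0, q') ∈ out q
  vec_eq_zero : ∀ q ∈ player, ∀ e ∈ out q, e.1 = 0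

namespace UnitPVASS

variable {C : Type} {d : ℕ}

/-- The counter values after adding the vector `z`, which is meant not to make any negative. -/
def shift (v : Fin d → ℕ) (z : Fin d → ℤ) : Fin d → ℕ := fun i => ((v i : ℤ) + z i).toNat

theorem shift_zero (v : Fin d → ℕ) : shift v 0 = v := by
  ext; simp [shift]

/-- The edges leaving `q` whose vector does not make any of the counters `v` negative. -/
def enabledOut (G : UnitPVASS C d) (q : C) (v : Fin d → ℕ) : Set ((Fin d → ℤ) × C) :=
  {e ∈ G.out q | ∀ i, 0 ≤ (v i : ℤ) + e.1 i}

theorem enabledOut_eq_pair {G : UnitPVASS C d} {q q' : C} {e : (Fin d → ℤ) × C} {v : Fin d → ℕ}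
    (h : G.out q = {e, (0, q')}) (he : ∀ i, 0 ≤ (v i : ℤ) + e.1 i) :
    G.enabledOut q v = {e, (0, q')} := by
  rw [enabledOut, h, Set.sep_eq_self_iff_mem_true]
  rintro _ (rfl | rfl)
  exacts [he, by simp]

theorem enabledOut_eq_singleton {G : UnitPVASS C d} {q q' : C} {e : (Fin d → ℤ) × C}
    {v : Fin d → ℕ} (h : G.out q = {e, (0, q')}) (he : ¬ ∀ i, 0 ≤ (v i : ℤ) + e.1 i) :
    G.enabledOut q v = {(0, q')} := by
  ext e'
  constructor
  · rintro ⟨he', hv⟩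
    rw [h] at he'
    rcases he' with rfl | he'
    exacts [absurd hv he, he']
  · rintro rfl
    exact ⟨by simp [h], by simp⟩

section Cfg

variable [Finite C]

/-- The configuration with control state `q` and counters `v`, once the control states are
numbered. -/
noncomputable def cfg (q : C) (v : Fin d → ℕ) : Config (Fin (Nat.card C)) d :=
  ⟨Finite.equivFin C q, v⟩

theorem exists_cfg_eq (c : Config (Fin (Nat.card C)) d) : ∃ (q : C) (v : Fin d → ℕ), cfg q v = c :=
  ⟨(Finite.equivFin C).symm c.state, c.val, by simp [cfg]⟩

theorem cfg_state_eq_iff {q q' : C} {v : Fin d → ℕ} :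
    (cfg q v).state = Finite.equivFin C q' ↔ q = q' :=
  (Finite.equivFin C).apply_eq_iff_eq

/-- The transition along the edge `e` from `q`, once the control states are numbered. -/
noncomputable def edgeTransition (q : C) (e : (Fin d → ℤ) × C) :
    Transition (Fin (Nat.card C)) d :=
  ⟨Finite.equivFin C q, e.1, Finite.equivFin C e.2⟩

theorem edgeTransition_injective (q : C) :
    Function.Injective (edgeTransition (d := d) q) := by
  rintro ⟨z, q₁⟩ ⟨z', q₁'⟩ h
  simpa [edgeTransition] using h

end Cfg

variable [Finite C] (G : UnitPVASS C d)

/-- The MDP presented by `G`. -/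
noncomputable def mdp : VASSMDP (Fin (Nat.card C)) d where
  Q₁ := (Set.toFinite (Finite.equivFin C '' G.player)).toFinset
  T := (Set.finite_iUnion fun q => (G.finite_out q).image (edgeTransition q)).toFinset
  weight _ := 1
  weight_pos _ _ := one_pos

theorem mem_mdp_transitions {t : Transition (Fin (Nat.card C)) d} :
    t ∈ G.mdp.T ↔ ∃ q, ∃ e ∈ G.out q, edgeTransition q e = t := by
  simp [mdp]

theorem equivFin_mem_player {q : C} : Finite.equivFin C q ∈ G.mdp.Q₁ ↔ q ∈ G.player := by
  simp [mdp]

variable {G} in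
theorem mem_transitions_and_enabled_iff {q : C} {v : Fin d → ℕ}
    {t : Transition (Fin (Nat.card C)) d} :
    t ∈ G.mdp.T ∧ t.Enabled (cfg q v) ↔ ∃ e ∈ G.enabledOut q v, edgeTransition q e = t := by
  rw [mem_mdp_transitions]
  constructor
  · rintro ⟨⟨q', e, he, rfl⟩, hq, hv⟩
    obtain rfl : q' = q := (Finite.equivFin C).injective hq
    exact ⟨e, ⟨he, hv⟩, rfl⟩
  · rintro ⟨e, ⟨he, hv⟩, rfl⟩
    exact ⟨⟨q, e, he, rfl⟩, rfl, hv⟩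

variable {G} in
theorem step_cfg_iff {q : C} {v : Fin d → ℕ} {c' : Config (Fin (Nat.card C)) d} :
    G.mdp.Step (cfg q v) c' ↔ ∃ e ∈ G.enabledOut q v, c' = cfg e.2 (shift v e.1) := by
  simp only [VASSMDP.Step, ← and_assoc, mem_transitions_and_enabled_iff]
  constructor
  · rintro ⟨_, ⟨e, he, rfl⟩, rfl⟩
    exact ⟨e, he, rfl⟩
  · rintro ⟨e, he, rfl⟩
    exact ⟨_, ⟨e, he, rfl⟩, rfl⟩

variable {G} in
theorem step_of_zero_mem_out {q q' : C} (h : (0, q') ∈ G.out q) (v : Fin d → ℕ) :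
    G.mdp.Step (cfg q v) (cfg q' v) :=
  step_cfg_iff.2 ⟨(0, q'), ⟨h, by simp⟩, by rw [shift_zero]⟩

theorem deadlockFree : G.mdp.DeadlockFree := by
  intro c
  obtain ⟨q, v, rfl⟩ := exists_cfg_eq c
  obtain ⟨q', h⟩ := G.exists_zero_mem_out q
  exact ⟨_, step_of_zero_mem_out h v⟩

theorem isPVASS : G.mdp.IsPVASS := by
  intro t ht hQ
  obtain ⟨q, e, he, rfl⟩ := G.mem_mdp_transitions.1 ht
  exact G.vec_eq_zero q (G.equivFin_mem_player.1 hQ) e he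

section Lintegral

variable {G} {q : C} {v : Fin d → ℕ} (g : Config (Fin (Nat.card C)) d → ℝ≥0∞)

theorem lintegral_succDist_cfg {E : Finset ((Fin d → ℤ) × C)} (hE : G.enabledOut q v = E) :
    ∫⁻ y, g y ∂(G.mdp.succDist G.deadlockFree (cfg q v)).toMeasure =
      (∑ e ∈ E, g (cfg e.2 (shift v e.1))) / E.card := by
  rw [G.mdp.lintegral_succDist_of_weight_eq_one G.deadlockFree (fun _ _ => rfl)
    (E := E.map ⟨edgeTransition q, edgeTransition_injective q⟩) (fun t => ?_),
    Finset.sum_map, Finset.card_map]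
  · rfl
  · simp only [mem_transitions_and_enabled_iff, hE, Finset.mem_map, Finset.mem_coe,
      Function.Embedding.coeFn_mk]

theorem lintegral_succDist_cfg_singleton {e : (Fin d → ℤ) × C} (hE : G.enabledOut q v = {e}) :
    ∫⁻ y, g y ∂(G.mdp.succDist G.deadlockFree (cfg q v)).toMeasure =
      g (cfg e.2 (shift v e.1)) := by
  rw [lintegral_succDist_cfg g (E := {e}) (by rw [hE, Finset.coe_singleton])]
  simp

theorem lintegral_succDist_cfg_pair {e e' : (Fin d → ℤ) × C} (hE : G.enabledOut q v = {e, e'})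
    (hne : e ≠ e') :
    ∫⁻ y, g y ∂(G.mdp.succDist G.deadlockFree (cfg q v)).toMeasure =
      (g (cfg e.2 (shift v e.1)) + g (cfg e'.2 (shift v e'.1))) / 2 := by
  classical
  rw [lintegral_succDist_cfg g (E := {e, e'}) (by simpa using hE), Finset.sum_pair hne,
    Finset.card_pair hne, Nat.cast_ofNat]

end Lintegral

/-- The input of the reachability problems that consists of the MDP presented by `G`, the initial
configuration `cfg q v` and the target control state `qF`. -/
noncomputable def toPInstance (q : C) (v : Fin d → ℕ) (qF : C) : PInstance d where
  numStates := Nat.card C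
  sys := G.mdp
  deadlockFree := G.deadlockFree
  isPVASS := G.isPVASS
  init := cfg q v
  target := Finite.equivFin C qF

end UnitPVASS

namespace PInstance

variable {d : ℕ}

theorem transitionCode_injective (I : PInstance d) : Function.Injective I.transitionCode := by
  intro t t' h
  simp only [transitionCode, Prod.mk.injEq, Fin.val_inj] at h
  exact Transition.ext h.1 (List.ofFn_injective h.2.1) h.2.2.1

/-- The description of `I` that lists the transitions in an arbitrarily chosen order. -/
noncomputable def code (I : PInstance d) : Code :=
  (List.ofFn fun q => decide (q ∈ I.sys.Q₁), I.sys.T.toList.map I.transitionCode,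
    ((I.init.state : ℕ), List.ofFn I.init.val), (I.target : ℕ))

theorem isCode_code (I : PInstance d) : I.IsCode I.code where
  states := rfl
  nodup := (Finset.nodup_toList _).map I.transitionCode_injective
  transitions _ := List.mem_map.trans <|
    exists_congr fun _ => and_congr Finset.mem_toList eq_comm
  init := rfl
  target := rfl

theorem prob_le_one (I : PInstance d) (σ : I.sys.Strategy)
    (E : Set (ℕ → Config (Fin I.numStates) d)) : I.prob σ E ≤ 1 :=
  MeasureTheory.prob_le_one (μ := I.sys.playMeasure I.deadlockFree σ I.init)

theorem prob_repeatedReachEvent_le (I : PInstance d) (σ : I.sys.Strategy) :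
    I.prob σ (repeatedReachEvent I.target) ≤ I.prob σ (reachEvent I.target) :=
  measure_mono (VASSMDP.repeatedReachEvent_subset_reachEvent _)

variable {I : PInstance d}

theorem iSup_prob_eq_one {E : Set (ℕ → Config (Fin I.numStates) d)} {σ : I.sys.Strategy}
    (h : I.prob σ E = 1) : ⨆ σ : I.sys.Strategy, I.prob σ E = 1 :=
  le_antisymm (iSup_le fun σ => I.prob_le_one σ E) (h ▸ le_iSup (fun σ => I.prob σ E) σ)

theorem AlmostSureReach.limitSureReach : I.AlmostSureReach → I.LimitSureReach := fun ⟨_, h⟩ =>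
  iSup_prob_eq_one h

theorem AlmostSureRepeatedReach.limitSureRepeatedReach :
    I.AlmostSureRepeatedReach → I.LimitSureRepeatedReach := fun ⟨_, h⟩ =>
  iSup_prob_eq_one h

theorem AlmostSureRepeatedReach.almostSureReach :
    I.AlmostSureRepeatedReach → I.AlmostSureReach := fun ⟨σ, h⟩ =>
  ⟨σ, le_antisymm (I.prob_le_one σ _) (h.ge.trans (I.prob_repeatedReachEvent_le σ))⟩

theorem LimitSureRepeatedReach.limitSureReach :
    I.LimitSureRepeatedReach → I.LimitSureReach := fun h =>
  le_antisymm (iSup_le fun σ => I.prob_le_one σ _)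
    (h.ge.trans (iSup_mono I.prob_repeatedReachEvent_le))

theorem not_limitSureReach_of_prob_le {b : ℝ≥0∞} (hb : b < 1)
    (h : ∀ σ : I.sys.Strategy, I.prob σ (reachEvent I.target) ≤ b) : ¬ I.LimitSureReach :=
  ((iSup_le h).trans_lt hb).ne

end PInstance

/-- A machine with finitely many states that acts on one natural number: in state `s` the number
`m * k + r` with `r < m = modulus s` is replaced by `factor s * k + offset s r`, and control passes
to the state or the exit `next s r`. -/
structure ResidueMachine (X : Type) where
  State : Type
  finite : Finite State
  start : State
  modulus : State → ℕ
  factor : State → ℕ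
  offset : State → ℕ → ℕ
  next : State → ℕ → State ⊕ X
  modulus_pos : ∀ s, 0 < modulus s

namespace ResidueMachine

attribute [instance] ResidueMachine.finite

variable {X Y : Type}

/-- One step of `M`, on pairs of a state or exit and a number. -/
inductive Step (M : ResidueMachine X) : (M.State ⊕ X) × ℕ → (M.State ⊕ X) × ℕ → Prop
  | mk (s : M.State) (k r : ℕ) (h : r < M.modulus s) :
    Step M (.inl s, M.modulus s * k + r) (M.next s r, M.factor s * k + M.offset s r)

/-- Started on `N`, the machine `M` leaves through the exit `x` with the number `N'`. -/
def Eval (M : ResidueMachine X) (N : ℕ) (x : X) (N' : ℕ) : Prop :=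
  Relation.ReflTransGen M.Step (.inl M.start, N) (.inr x, N')

/-- The machine that leaves after one step, which replaces `m * k + r` by `a * k + b r`. -/
def single {m : ℕ} (hm : 0 < m) (a : ℕ) (b : ℕ → ℕ) (x : ℕ → X) : ResidueMachine X where
  State := Unit
  finite := inferInstance
  start := ()
  modulus _ := m
  factor _ := a
  offset _ := b
  next _ r := .inr (x r)
  modulus_pos _ := hm

theorem eval_single {m : ℕ} (hm : 0 < m) (a : ℕ) (b : ℕ → ℕ) (x : ℕ → X) (k : ℕ) {r : ℕ}
    (hr : r < m) : (single hm a b x).Eval (m * k + r) (x r) (a * k + b r) :=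
  .single (Step.mk (M := single hm a b x) () k r hr)

/-- The machine whose exit tells whether the number is divisible by `p`. -/
def testDvd {p : ℕ} (hp : 0 < p) : ResidueMachine Bool :=
  single hp p (fun r => r) fun r => decide (r = 0)

theorem eval_testDvd {p : ℕ} (hp : 0 < p) (N : ℕ) : (testDvd hp).Eval N (decide (p ∣ N)) N := by
  have h := eval_single hp p (fun r => r) (fun r => decide (r = 0)) (N / p) (Nat.mod_lt N hp)
  simpa only [testDvd, Nat.div_add_mod, ← Nat.dvd_iff_mod_eq_zero] using h

/-- The machine that runs `M`, then continues with `K x`, where `x` is the exit of `M`. -/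
def bind [Finite X] (M : ResidueMachine X) (K : X → ResidueMachine Y) : ResidueMachine Y where
  State := M.State ⊕ Σ x, (K x).State
  finite := inferInstance
  start := .inl M.start
  modulus := Sum.elim M.modulus fun z => (K z.1).modulus z.2
  factor := Sum.elim M.factor fun z => (K z.1).factor z.2
  offset := Sum.elim M.offset fun z => (K z.1).offset z.2
  next := Sum.elim
    (fun s r => .inl ((M.next s r).map id fun x => ⟨x, (K x).start⟩))
    (fun z r => ((K z.1).next z.2 r).map (fun s => .inr ⟨z.1, s⟩) id)
  modulus_pos := by
    rintro (s | z)
    exacts [M.modulus_pos s, (K z.1).modulus_pos z.2]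

theorem Eval.bind [Finite X] {M : ResidueMachine X} {K : X → ResidueMachine Y} {N N' N'' : ℕ}
    {x : X} {y : Y} (h : M.Eval N x N') (h' : (K x).Eval N' y N'') :
    (M.bind K).Eval N y N'' := by
  have run := Relation.ReflTransGen.lift (p := (M.bind K).Step)
    (fun z : (M.State ⊕ X) × ℕ =>
      ((.inl (z.1.map id fun x => ⟨x, (K x).start⟩) : (M.bind K).State ⊕ Y), z.2))
    (by rintro _ _ ⟨s, k, r, hr⟩; exact Step.mk (M := M.bind K) (.inl s) k r hr) _ _ h
  have run' := Relation.ReflTransGen.lift (p := (M.bind K).Step)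
    (fun z : ((K x).State ⊕ Y) × ℕ =>
      ((z.1.map (fun s => .inr ⟨x, s⟩) id : (M.bind K).State ⊕ Y), z.2))
    (by rintro _ _ ⟨s, k, r, hr⟩; exact Step.mk (M := M.bind K) (.inr ⟨x, s⟩) k r hr) _ _ h'
  exact run.trans run'

/-- The machine that runs `M` as long as the number is divisible by `p`. -/
def whileDvd {p : ℕ} (hp : 0 < p) (M : ResidueMachine Unit) : ResidueMachine Unit where
  State := Option M.State
  finite := inferInstance
  start := none
  modulus s := s.elim p M.modulus
  factor s := s.elim p M.factor
  offset s r := s.elim r fun s => M.offset s r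
  next s r := s.elim (if r = 0 then .inl (some M.start) else .inr ())
    fun s => .inl ((M.next s r).elim some fun _ => none)
  modulus_pos := by
    rintro (_ | s)
    exacts [hp, M.modulus_pos s]

theorem step_whileDvd_none {p : ℕ} (hp : 0 < p) (M : ResidueMachine Unit) (N : ℕ) :
    (whileDvd hp M).Step (.inl none, N)
      (if p ∣ N then .inl (some M.start) else .inr (), N) := by
  have h := Step.mk (M := whileDvd hp M) none (N / p) (N % p) (Nat.mod_lt N hp)
  simpa only [whileDvd, Option.elim_none, Nat.div_add_mod, ← Nat.dvd_iff_mod_eq_zero] using h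

theorem eval_whileDvd_of_not_dvd {p N : ℕ} (hp : 0 < p) (M : ResidueMachine Unit)
    (h : ¬ p ∣ N) : (whileDvd hp M).Eval N () N := by
  have test := step_whileDvd_none hp M N
  rw [if_neg h] at test
  exact .single test

theorem eval_whileDvd_of_dvd {p N N' N'' : ℕ} (hp : 0 < p) {M : ResidueMachine Unit}
    (h : p ∣ N) (body : M.Eval N () N') (rest : (whileDvd hp M).Eval N' () N'') :
    (whileDvd hp M).Eval N () N'' := by
  have test := step_whileDvd_none hp M N
  rw [if_pos h] at test
  have run := Relation.ReflTransGen.lift (p := (whileDvd hp M).Step)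
    (fun z : (M.State ⊕ Unit) × ℕ =>
      ((.inl (z.1.elim some fun _ => none) : (whileDvd hp M).State ⊕ Unit), z.2))
    (by rintro _ _ ⟨s, k, r, hr⟩; exact Step.mk (M := whileDvd hp M) (some s) k r hr) _ _ body
  exact (Relation.ReflTransGen.head test run).trans rest

end ResidueMachine

/-- The contents of countably many registers. -/
abbrev Store := ℕ → ℕ

/-- `N` encodes the register contents `s`: register `i` is the exponent of the `i`-th prime. -/
def RegisterCode (s : Store) (N : ℕ) : Prop :=
  N ≠ 0 ∧ ∀ i, N.factorization (Nat.nth Nat.Prime i) = s i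

namespace RegisterCode

open Function

variable {s : Store} {N : ℕ}

theorem dvd_iff (h : RegisterCode s N) (i : ℕ) : Nat.nth Nat.Prime i ∣ N ↔ s i ≠ 0 := by
  rw [← h.2 i, (Nat.prime_nth_prime i).dvd_iff_one_le_factorization h.1, Nat.one_le_iff_ne_zero]

theorem mul (h : RegisterCode s N) (i : ℕ) :
    RegisterCode (update s i (s i + 1)) (Nat.nth Nat.Prime i * N) := by
  refine ⟨mul_ne_zero (Nat.prime_nth_prime i).ne_zero h.1, fun j => ?_⟩
  rw [Nat.factorization_mul (Nat.prime_nth_prime i).ne_zero h.1, Finsupp.add_apply, h.2,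
    (Nat.prime_nth_prime i).factorization, Finsupp.single_apply, update_apply]
  simp only [(Nat.nth_injective Nat.infinite_setOfPred_prime).eq_iff]
  by_cases hij : i = j
  · simp [hij, add_comm]
  · simp [hij, Ne.symm hij]

theorem exists_mul (h : RegisterCode s N) {i : ℕ} (hi : s i ≠ 0) :
    ∃ N', N = Nat.nth Nat.Prime i * N' ∧ RegisterCode (update s i (s i - 1)) N' := by
  obtain ⟨N', rfl⟩ := (h.dvd_iff i).2 hi
  have hN : N' ≠ 0 := right_ne_zero_of_mul h.1
  have hs := (RegisterCode.mul ⟨hN, fun _ => rfl⟩ i).2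
  refine ⟨N', rfl, hN, fun j => ?_⟩
  have hj := (h.2 j).symm.trans (hs j)
  have hi' := (h.2 i).symm.trans (hs i)
  simp only [update_apply] at hj hi' ⊢
  split_ifs at hj ⊢ with hij
  · subst hij
    omega
  · exact hj.symm

theorem init (n : ℕ) : RegisterCode (update (fun _ => 0) 0 n) (2 ^ n) := by
  refine ⟨by positivity, fun j => ?_⟩
  rw [Nat.prime_two.factorization_pow, ← Nat.nth_prime_zero_eq_two, Finsupp.single_apply,
    update_apply]
  simp only [(Nat.nth_injective Nat.infinite_setOfPred_prime).eq_iff, eq_comm]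

end RegisterCode

/-- Some machine transforms the codes of register contents as prescribed by the relation `R`. -/
def Realizable (R : Store → Store → Prop) : Prop :=
  ∃ M : ResidueMachine Unit, ∀ s s' N, R s s' → RegisterCode s N →
    ∃ N', RegisterCode s' N' ∧ M.Eval N () N'

namespace Realizable

open Function

variable {R R' : Store → Store → Prop}

theorem mono (h : Realizable R) (hR : ∀ s s', R' s s' → R s s') : Realizable R' :=
  h.imp fun _ hM s s' N hs => hM s s' N (hR s s' hs)

theorem inc (i : ℕ) : Realizable fun s s' => s' = update s i (s i + 1) := by
  refine ⟨.single one_pos (Nat.nth Nat.Prime i) (fun _ => 0) fun _ => (), ?_⟩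
  rintro s _ N rfl hN
  refine ⟨_, hN.mul i, ?_⟩
  simpa using ResidueMachine.eval_single one_pos (Nat.nth Nat.Prime i) (fun _ => 0)
    (fun _ => ()) N zero_lt_one

theorem dec (i : ℕ) : Realizable fun s s' => s i ≠ 0 ∧ s' = update s i (s i - 1) := by
  have hp := (Nat.prime_nth_prime i).pos
  refine ⟨.single hp 1 (fun _ => 0) fun _ => (), ?_⟩
  rintro s _ N ⟨hi, rfl⟩ hN
  obtain ⟨N', rfl, hN'⟩ := hN.exists_mul hi
  refine ⟨N', hN', ?_⟩
  simpa using ResidueMachine.eval_single hp 1 (fun _ => 0) (fun _ => ()) N' hp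

theorem comp (h : Realizable R) (h' : Realizable R') : Realizable (Relation.Comp R R') := by
  obtain ⟨M, hM⟩ := h
  obtain ⟨M', hM'⟩ := h'
  refine ⟨M.bind fun _ => M', ?_⟩
  rintro s s'' N ⟨s', hs, hs'⟩ hN
  obtain ⟨N', hN', run⟩ := hM _ _ _ hs hN
  obtain ⟨N'', hN'', run'⟩ := hM' _ _ _ hs' hN'
  exact ⟨N'', hN'', run.bind run'⟩

theorem id : Realizable fun s s' => s' = s :=
  ((inc 0).comp (dec 0)).mono fun s s' h => ⟨_, rfl, by simp, by simp [h]⟩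

theorem whileNonzero (i : ℕ) (h : Realizable R) : Realizable fun s s' =>
    ∃ (n : ℕ) (st : ℕ → Store), st 0 = s ∧ st n = s' ∧ s' i = 0 ∧
      ∀ k < n, st k i ≠ 0 ∧ R (st k) (st (k + 1)) := by
  obtain ⟨M, hM⟩ := h
  have hp := (Nat.prime_nth_prime i).pos
  refine ⟨M.whileDvd hp, ?_⟩
  rintro _ _ N ⟨n, st, rfl, rfl, hi, hst⟩ hN
  induction n generalizing st N with
  | zero => exact ⟨N, hN, ResidueMachine.eval_whileDvd_of_not_dvd _ _ fun hd =>
      (hN.dvd_iff i).1 hd hi⟩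
  | succ n ih =>
    obtain ⟨hi₀, hR⟩ := hst 0 n.succ_pos
    obtain ⟨N', hN', body⟩ := hM _ _ _ hR hN
    obtain ⟨N'', hN'', rest⟩ := ih N' (fun k => st (k + 1)) hi
      (fun k hk => hst (k + 1) (by omega)) hN'
    exact ⟨N'', hN'', ResidueMachine.eval_whileDvd_of_dvd hp ((hN.dvd_iff i).2 hi₀) body rest⟩

theorem countdown (i : ℕ) (h : Realizable R) : Realizable fun s s' =>
    ∃ st : ℕ → Store, st 0 = s ∧ st (s i) = s' ∧ (∀ k ≤ s i, st k i = s i - k) ∧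
      ∀ k < s i, R (update (st k) i (s i - (k + 1))) (st (k + 1)) := by
  refine (((dec i).comp h).whileNonzero i).mono ?_
  rintro s _ ⟨st, hst₀, rfl, hi, hst⟩
  refine ⟨s i, st, hst₀, rfl, by rw [hi _ le_rfl, Nat.sub_self], fun k hk => ?_⟩
  have hik := hi k hk.le
  exact ⟨by omega, _, ⟨by omega, rfl⟩, by simpa only [hik, Nat.sub_sub] using hst k hk⟩

theorem clear (i : ℕ) : Realizable fun s s' => s' = update s i 0 := by
  refine (id.countdown i).mono ?_
  rintro s _ rfl
  exact ⟨fun k => update s i (s i - k), by simp, by simp, by simp, by simp⟩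

theorem move {i j : ℕ} (hij : i ≠ j) :
    Realizable fun s s' => s' = update (update s j (s i)) i 0 := by
  refine ((clear j).comp ((inc j).countdown i)).mono ?_
  rintro s _ rfl
  refine ⟨_, rfl, fun k => update (update s j k) i (s i - k), ?_, ?_, ?_, ?_⟩
  · ext x; simp only [update_apply]; grind
  · simp [hij]
  · simp [hij]
  · intro k _; ext x; simp only [update_apply]; grind

theorem copy {i j t : ℕ} (hij : i ≠ j) (hit : i ≠ t) (hjt : j ≠ t) :
    Realizable fun s s' => s t = 0 ∧ s' = update s j (s i) := by
  refine ((clear j).comp ((((inc j).comp (inc t)).countdown i).comp (move hit.symm))).mono ?_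
  rintro s _ ⟨ht, rfl⟩
  refine ⟨_, rfl, update (update (update s j (s i)) t (s i)) i 0,
    ⟨fun k => update (update (update s j k) t k) i (s i - k), ?_, ?_, ?_, ?_⟩, ?_⟩
  · ext x; simp only [update_apply]; grind
  · simp [hij]
  · simp [hij]
  · intro k _
    refine ⟨_, rfl, ?_⟩
    ext x; simp only [update_apply]; grind
  · ext x; simp only [update_apply]; grind

theorem clearBlock (base n : ℕ) :
    Realizable fun s s' => s' = fun x => if base ≤ x ∧ x < base + n then 0 else s x := by
  induction n with
  | zero => exact id.mono fun s s' h => h.trans (by ext x; grind)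
  | succ n ih =>
    refine (ih.comp (clear (base + n))).mono ?_
    rintro s _ rfl
    refine ⟨_, rfl, ?_⟩
    ext x; simp only [update_apply]; grind

end Realizable

theorem map_congr_of_forall_mem {n : ℕ} {v : List.Vector ℕ n} {s s' : Store}
    (h : ∀ i ∈ v.toList, s i = s' i) : v.map s = v.map s' :=
  List.Vector.toList_injective (by simpa only [List.Vector.toList_map] using List.map_congr_left h)

/-- Some machine evaluates `f` on the contents of the registers `inp` and writes the result to the
register `out`, which may be one of `inp`. The registers from `base` on are scratch space, empty
before and after. -/
def RealizesFun {n : ℕ} (f : List.Vector ℕ n →. ℕ) : Prop :=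
  ∀ (inp : List.Vector ℕ n) (out base : ℕ), (∀ i ∈ inp.toList, i < base) → out < base →
    Realizable fun s s' => (∀ j ≥ base, s j = 0) ∧
      ∃ y ∈ f (inp.map s), s' = Function.update s out y

namespace RealizesFun

open Function

theorem of_total {n : ℕ} {f : List.Vector ℕ n → ℕ}
    (h : ∀ (inp : List.Vector ℕ n) (out base : ℕ), (∀ i ∈ inp.toList, i < base) → out < base →
      Realizable fun s s' => (∀ j ≥ base, s j = 0) ∧ s' = update s out (f (inp.map s))) :
    RealizesFun (f : List.Vector ℕ n →. ℕ) := by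
  intro inp out base hinp hout
  refine (h inp out base hinp hout).mono ?_
  rintro s _ ⟨hs, y, hy, rfl⟩
  exact ⟨hs, by rw [Part.mem_some_iff.1 hy]⟩

theorem realizable_update {n : ℕ} {f : List.Vector ℕ n → ℕ}
    (hf : RealizesFun (f : List.Vector ℕ n →. ℕ)) {inp : List.Vector ℕ n} {out base : ℕ}
    (hinp : ∀ i ∈ inp.toList, i < base) (hout : out < base) :
    Realizable fun s s' => (∀ j ≥ base, s j = 0) ∧ s' = update s out (f (inp.map s)) :=
  (hf inp out base hinp hout).mono fun _ _ h => ⟨h.1, _, Part.mem_some _, h.2⟩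

theorem zero :
    RealizesFun ((fun _ => 0 : List.Vector ℕ 0 → ℕ) : List.Vector ℕ 0 →. ℕ) :=
  of_total fun _ out _ _ _ => (Realizable.clear out).mono fun _ _ h => h.2

theorem get {n : ℕ} (i : Fin n) :
    RealizesFun ((fun v => v.get i : List.Vector ℕ n → ℕ) : List.Vector ℕ n →. ℕ) := by
  refine of_total fun inp out base hinp hout => ?_
  simp only [List.Vector.get_map]
  have hi : inp.get i < base := hinp _ (List.Vector.get_mem i inp)
  rcases eq_or_ne (inp.get i) out with rfl | hne
  · exact Realizable.id.mono fun s s' h => by simpa using h.2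
  · exact (Realizable.copy hne hi.ne hout.ne).mono fun s s' h => ⟨h.1 base le_rfl, h.2⟩

theorem succ : RealizesFun
    ((fun v => Nat.succ v.head : List.Vector ℕ 1 → ℕ) : List.Vector ℕ 1 →. ℕ) := by
  refine of_total fun inp out base hinp hout => ?_
  refine (((get 0).realizable_update hinp hout).comp (Realizable.inc out)).mono ?_
  rintro s _ ⟨hs, rfl⟩
  exact ⟨_, ⟨hs, rfl⟩, by simp⟩

end RealizesFun

/-- The store obtained from `s` by writing the list `l` to the registers from `base` on. -/
def writeBlock (base : ℕ) (l : List ℕ) (s : Store) : Store :=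
  fun x => if x < base then s x else l.getD (x - base) (s x)

theorem writeBlock_nil (base : ℕ) (s : Store) : writeBlock base [] s = s := by
  ext x
  simp [writeBlock]

theorem writeBlock_cons (base a : ℕ) (l : List ℕ) (s : Store) :
    writeBlock base (a :: l) s = writeBlock (base + 1) l (Function.update s base a) := by
  ext x
  rcases lt_trichotomy x base with hx | rfl | hx
  · simp [writeBlock, hx, hx.ne, hx.trans (Nat.lt_succ_self _)]
  · simp [writeBlock]
  · obtain ⟨k, rfl⟩ := Nat.exists_eq_add_of_lt hx
    simp [writeBlock, show base + k + 1 - base = k + 1 by omega,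
      show ¬ base + k + 1 < base by omega, show base + k + 1 ≠ base by omega]

/-- The registers `base, …, base + n - 1`. -/
def block (base n : ℕ) : List.Vector ℕ n :=
  ⟨List.range' base n, List.length_range'⟩

theorem map_writeBlock_block {n : ℕ} (base : ℕ) (w : List.Vector ℕ n) (s : Store) :
    (block base n).map (writeBlock base w.toList s) = w := by
  refine List.Vector.toList_injective ?_
  rw [List.Vector.toList_map, block, List.Vector.toList_mk]
  exact List.ext_getElem (by simp) fun k _ hk => by
    simp [writeBlock, List.getElem?_eq_getElem hk]

namespace RealizesFun

open Function

theorem realizable_writeBlock {m n : ℕ} {g : Fin n → List.Vector ℕ m →. ℕ}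
    (hg : ∀ i, RealizesFun (g i)) {inp : List.Vector ℕ m} {base : ℕ}
    (hinp : ∀ i ∈ inp.toList, i < base) :
    Realizable fun s s' => (∀ j ≥ base, s j = 0) ∧
      ∃ w ∈ List.Vector.mOfFn fun i => g i (inp.map s), s' = writeBlock base w.toList s := by
  induction n generalizing base with
  | zero =>
    refine Realizable.id.mono ?_
    rintro s _ ⟨-, w, -, rfl⟩
    rw [w.eq_nil, List.Vector.toList_nil, writeBlock_nil]
  | succ n ih =>
    have hinp' : ∀ i ∈ inp.toList, i < base + 1 := fun i hi => (hinp i hi).trans_le base.le_succ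
    refine ((hg 0 inp base (base + 1) hinp' base.lt_succ_self).comp
      (ih (fun i => hg i.succ) hinp')).mono ?_
    rintro s _ ⟨hs, w, hw, rfl⟩
    obtain ⟨a, ha, hw⟩ := Part.mem_bind_iff.1 hw
    obtain ⟨w, hw', h⟩ := Part.mem_bind_iff.1 hw
    obtain rfl := Part.mem_some_iff.1 h
    have hmap : inp.map (update s base a) = inp.map s :=
      map_congr_of_forall_mem fun i hi => update_of_ne (hinp i hi).ne _ _
    refine ⟨update s base a, ⟨fun j hj => hs j (by omega), a, ha, rfl⟩, fun j hj => ?_, w, ?_, ?_⟩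
    · rw [update_of_ne (by omega), hs j (by omega)]
    · simpa only [hmap] using hw'
    · rw [List.Vector.toList_cons, writeBlock_cons]

theorem comp {m n : ℕ} {f : List.Vector ℕ n →. ℕ} {g : Fin n → List.Vector ℕ m →. ℕ}
    (hf : RealizesFun f) (hg : ∀ i, RealizesFun (g i)) :
    RealizesFun fun v => (List.Vector.mOfFn fun i => g i v).bind f := by
  intro inp out base hinp hout
  have hblock : ∀ i ∈ (block base n).toList, i < base + n := fun i hi => by
    simp only [block, List.Vector.toList_mk, List.mem_range'_1] at hi
    exact hi.2
  refine ((realizable_writeBlock hg hinp).comp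
    ((hf (block base n) out (base + n) hblock (by omega)).comp
    (Realizable.clearBlock base n))).mono ?_
  rintro s _ ⟨hs, y, hy, rfl⟩
  obtain ⟨w, hw, hy⟩ := Part.mem_bind_iff.1 hy
  refine ⟨_, ⟨hs, w, hw, rfl⟩, _, ⟨fun j hj => ?_, y, ?_, rfl⟩, ?_⟩
  · have hlen := w.toList_length
    simp only [writeBlock, hs j (by omega)]
    grind
  · rwa [map_writeBlock_block]
  · ext x
    have hx := hs x
    have hlen := w.toList_length
    simp only [writeBlock, update_apply]
    grind

/-- One round of the recursion: register `o` counts the rounds, register `o + 1` holds the number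
of rounds to go and register `o + 2` the value computed so far. -/
theorem realizable_rec {n : ℕ} {g : List.Vector ℕ (n + 2) → ℕ}
    (hg : RealizesFun (g : List.Vector ℕ (n + 2) →. ℕ)) {inp : List.Vector ℕ n} {o : ℕ}
    (hinp : ∀ i ∈ inp.toList, i < o) :
    Realizable fun s s' => (∀ j ≥ o + 3, s j = 0) ∧ s o = 0 ∧
      s' = update (update (update s o (s (o + 1))) (o + 1) 0) (o + 2)
        (Nat.rec (s (o + 2)) (fun y IH => g (y ::ᵥ IH ::ᵥ inp.map s)) (s (o + 1))) := by
  have round := ((hg.realizable_update (inp := o ::ᵥ (o + 2) ::ᵥ inp) (out := o + 2)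
    (base := o + 3) (by
      simp only [List.Vector.toList_cons, List.forall_mem_cons]
      exact ⟨by omega, by omega, fun i hi => (hinp i hi).trans (by omega)⟩) (by omega)).comp
    (Realizable.inc o)).countdown (o + 1)
  refine round.mono ?_
  rintro s _ ⟨hs, ho, rfl⟩
  let F : ℕ → ℕ := Nat.rec (s (o + 2)) fun y IH => g (y ::ᵥ IH ::ᵥ inp.map s)
  have hF₀ : F 0 = s (o + 2) := rfl
  let st : ℕ → Store := fun k =>
    update (update (update s o k) (o + 1) (s (o + 1) - k)) (o + 2) (F k)
  refine ⟨st, ?_, by simp only [st, Nat.sub_self, F], by simp [st],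
    fun k _ => ⟨_, ⟨fun j hj => ?_, rfl⟩, ?_⟩⟩
  · ext x; simp only [st, hF₀, update_apply]; grind
  · have hj' := hs j hj
    simp only [st, update_apply]; grind
  · have hmap : inp.map (update (st k) (o + 1) (s (o + 1) - (k + 1))) = inp.map s :=
      map_congr_of_forall_mem fun i hi => by
        have := hinp i hi
        simp only [st, update_apply]; grind
    have hFk : F (k + 1) = g (k ::ᵥ F k ::ᵥ inp.map s) := rfl
    simp only [List.Vector.map_cons, hmap]
    ext x; simp only [st, hFk, update_apply]; grind

theorem prec {n : ℕ} {f : List.Vector ℕ n → ℕ} {g : List.Vector ℕ (n + 2) → ℕ}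
    (hf : RealizesFun (f : List.Vector ℕ n →. ℕ))
    (hg : RealizesFun (g : List.Vector ℕ (n + 2) →. ℕ)) :
    RealizesFun ((fun v : List.Vector ℕ (n + 1) => v.head.rec (f v.tail)
      fun y IH => g (y ::ᵥ IH ::ᵥ v.tail) : List.Vector ℕ (n + 1) → ℕ) :
      List.Vector ℕ (n + 1) →. ℕ) := by
  refine of_total fun inp out o hinp hout => ?_
  obtain ⟨i, inp, rfl⟩ := inp.exists_eq_cons
  simp only [List.Vector.toList_cons, List.forall_mem_cons] at hinp
  obtain ⟨hi, hinp⟩ := hinp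
  refine ((Realizable.copy (i := i) (j := o + 1) (t := o + 2) (by omega) (by omega) (by omega)).comp
    ((hf.realizable_update (out := o + 2) (base := o + 3)
      (fun j hj => (hinp j hj).trans (by omega)) (by omega)).comp
    ((hg.realizable_rec hinp).comp
    ((Realizable.move (i := o + 2) (j := out) (by omega)).comp (Realizable.clear o))))).mono ?_
  rintro s _ ⟨hs, rfl⟩
  have hmap₁ : inp.map (update s (o + 1) (s i)) = inp.map s :=
    map_congr_of_forall_mem fun j hj => update_of_ne (by have := hinp j hj; omega) _ _
  have hmap₂ (a : ℕ) : inp.map (update (update s (o + 1) (s i)) (o + 2) a) = inp.map s :=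
    map_congr_of_forall_mem fun j hj => by
      have := hinp j hj
      simp only [update_apply]; grind
  have ho := hs o le_rfl
  have := hs (o + 1) (by omega)
  have ho₂ := hs (o + 2) (by omega)
  refine ⟨_, ⟨ho₂, rfl⟩, _, ⟨fun j hj => ?_, rfl⟩, _, ⟨fun j hj => ?_, ?_, rfl⟩, _, rfl, ?_⟩
  · rw [update_of_ne (by omega), hs j (by omega)]
  · rw [update_of_ne (by omega), update_of_ne (by omega), hs j (by omega)]
  · rw [update_of_ne (by omega), update_of_ne (by omega), ho]
  · simp only [hmap₁, hmap₂, List.Vector.map_cons, List.Vector.head_cons, List.Vector.tail_cons]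
    ext x
    simp only [update_apply]; grind

theorem rfind {n : ℕ} {f : List.Vector ℕ (n + 1) → ℕ}
    (hf : RealizesFun (f : List.Vector ℕ (n + 1) →. ℕ)) :
    RealizesFun fun v => Nat.rfind fun n => Part.some (decide (f (n ::ᵥ v) = 0)) := by
  intro inp out o hinp hout
  have test : Realizable fun s s' => (∀ j ≥ o + 2, s j = 0) ∧
      s' = update s (o + 1) (f (s o ::ᵥ inp.map s)) :=
    hf.realizable_update (inp := o ::ᵥ inp) (by
      simp only [List.Vector.toList_cons, List.forall_mem_cons]
      exact ⟨by omega, fun i hi => (hinp i hi).trans (by omega)⟩) (by omega)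
  refine (test.comp ((((Realizable.inc o).comp test).whileNonzero (o + 1)).comp
    (Realizable.move (i := o) (j := out) (by omega)))).mono ?_
  rintro s _ ⟨hs, y, hy, rfl⟩
  obtain ⟨hy₀, hlt⟩ := Nat.mem_rfind.1 hy
  simp only [Part.mem_some_iff, eq_comm (a := true), eq_comm (a := false), decide_eq_true_eq,
    decide_eq_false_iff_not] at hy₀ hlt
  have ho := hs o le_rfl
  have := hs (o + 1) (by omega)
  let st : ℕ → Store := fun k => update (update s o k) (o + 1) (f (k ::ᵥ inp.map s))
  have hmap (k : ℕ) : inp.map (update (st k) o (k + 1)) = inp.map s :=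
    map_congr_of_forall_mem fun i hi => by
      have := hinp i hi
      simp only [st, update_apply]; grind
  refine ⟨st 0, ⟨fun j hj => hs j (by omega), ?_⟩, st y, ⟨y, st, rfl, rfl, by simp [st, hy₀],
    fun k hk => ⟨by simpa [st] using hlt hk, update (st k) o (k + 1), by simp [st],
      fun j hj => ?_, ?_⟩⟩, ?_⟩
  · ext x; simp only [st, update_apply]; grind
  · have hj' := hs j (by omega)
    simp only [st, update_apply]; grind
  · rw [hmap, update_self]
    ext x; simp only [st, update_apply]; grind
  · ext x; simp only [st, update_apply]; grind

theorem of_primrec' {n : ℕ} {f : List.Vector ℕ n → ℕ} (hf : Nat.Primrec' f) :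
    RealizesFun (f : List.Vector ℕ n →. ℕ) := by
  induction hf with
  | zero => exact zero
  | succ => exact succ
  | get i => exact get i
  | comp g _ _ hf hg =>
    refine (congrArg RealizesFun (funext fun v => ?_)).mp (hf.comp hg)
    exact (congrArg (Part.bind · _) (List.Vector.mOfFn_pure _)).trans (Part.bind_some _ _)
  | prec _ _ hf hg => exact hf.prec hg

theorem of_partrec' {n : ℕ} {f : List.Vector ℕ n →. ℕ} (hf : Nat.Partrec' f) : RealizesFun f := by
  induction hf with
  | prim h => exact of_primrec' h
  | comp g _ _ hf hg => exact hf.comp hg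
  | rfind _ hf => exact hf.rfind

end RealizesFun

theorem exists_machine_of_partrec {f : ℕ →. ℕ} (hf : Partrec f) :
    ∃ M : ResidueMachine Bool, ∀ n, ∀ y ∈ f n, ∃ N, M.Eval (2 ^ n) (decide (y ≠ 0)) N := by
  obtain ⟨M, hM⟩ := RealizesFun.of_partrec' (Nat.Partrec'.part_iff₁.2 hf) (0 ::ᵥ .nil) 0 1
    (by simp) one_pos
  refine ⟨M.bind fun _ => .testDvd (Nat.prime_nth_prime 0).pos, fun n y hy => ?_⟩
  obtain ⟨N, hN, run⟩ := hM _ _ _ ⟨fun j hj => Function.update_of_ne (by omega) _ _, y,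
    by simpa using hy, rfl⟩ (RegisterCode.init n)
  have hdvd := hN.dvd_iff 0
  rw [Function.update_self] at hdvd
  simp only [← hdvd]
  exact ⟨N, run.bind (ResidueMachine.eval_testDvd _ N)⟩

namespace ResidueMachine

open UnitPVASS

/-- The vector in dimension two with entry `x` at `i` and entry `y` at the other index. -/
def vecAt {α : Type} (i : Fin 2) (x y : α) : Fin 2 → α := fun j => if j = i then x else y

theorem vecAt_self {α : Type} (i : Fin 2) (x y : α) : vecAt i x y i = x := if_pos rfl

theorem vecAt_rev {α : Type} (i : Fin 2) (x y : α) : vecAt i.rev x y = vecAt i y x := by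
  ext j
  fin_cases i <;> fin_cases j <;> rfl

theorem shift_vecAt (i : Fin 2) (x y : ℕ) (a b : ℤ) :
    shift (vecAt i x y) (vecAt i a b) = vecAt i (x + a).toNat (y + b).toNat := by
  ext j
  simp only [shift, vecAt]
  split_ifs <;> rfl

theorem add_vecAt_neg_nonneg_iff {v : Fin 2 → ℕ} {i : Fin 2} {m a : ℕ} :
    (∀ j, 0 ≤ (v j : ℤ) + vecAt i (-(m : ℤ)) (a : ℤ) j) ↔ m ≤ v i := by
  constructor
  · intro h
    have hi := h i
    rw [vecAt_self] at hi
    omega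
  · intro h j
    simp only [vecAt]
    split_ifs with hj
    · subst hj; omega
    · omega

/-- The control states of the MDP that simulates `M`. One counter, whose index is kept in the
control state, holds the number of `M`; the other one accumulates the next number, and the two
exchange their roles after each step of `M`. In `loc` Player 1 either moves to `dec`, where the
modulus is subtracted, or to `exit`, which announces the remainder; `check` punishes a wrong
announcement. -/
inductive Control (M : ResidueMachine Bool)
  | loc (s : M.State) (i : Fin 2)
  | dec (s : M.State) (i : Fin 2)
  | exit (s : M.State) (i : Fin 2) (r : Fin (M.modulus s))
  | check (t : M.State ⊕ Bool) (i : Fin 2)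
  | accept
  | sink

variable (M : ResidueMachine Bool)

instance : Finite M.Control := by
  refine Finite.of_surjective (α := (M.State × Fin 2) ⊕ (M.State × Fin 2) ⊕
    ((Σ s, Fin (M.modulus s)) × Fin 2) ⊕ ((M.State ⊕ Bool) × Fin 2) ⊕ Bool)
    (Sum.elim (fun z => .loc z.1 z.2) <| Sum.elim (fun z => .dec z.1 z.2) <|
      Sum.elim (fun z => .exit z.1.1 z.2 z.1.2) <| Sum.elim (fun z => .check z.1 z.2)
      fun b => bif b then .accept else .sink) ?_
  rintro (⟨s, i⟩ | ⟨s, i⟩ | ⟨s, i, r⟩ | ⟨t, i⟩ | _ | _)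
  exacts [⟨.inl (s, i), rfl⟩, ⟨.inr (.inl (s, i)), rfl⟩, ⟨.inr (.inr (.inl (⟨s, r⟩, i))), rfl⟩,
    ⟨.inr (.inr (.inr (.inl (t, i)))), rfl⟩, ⟨.inr (.inr (.inr (.inr true))), rfl⟩,
    ⟨.inr (.inr (.inr (.inr false))), rfl⟩]

variable {M}

/-- The control state that represents a state or an exit of `M`; the exit `true` accepts. -/
def entry (t : M.State ⊕ Bool) (i : Fin 2) : M.Control :=
  t.elim (fun s => .loc s i) fun b => bif b then .accept else .sink

/-- The vectors and targets of the transitions that leave a control state. The loops at `dec` and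
`exit` only keep the MDP free of deadlocks. -/
def out : M.Control → Set ((Fin 2 → ℤ) × M.Control)
  | .loc s i => insert (0, .dec s i) (Set.range fun r => (0, .exit s i r))
  | .dec s i => {(vecAt i (-(M.modulus s : ℤ)) (M.factor s : ℤ), .loc s i), (0, .dec s i)}
  | .exit s i r =>
    {(vecAt i (-((r : ℕ) : ℤ)) (M.offset s r : ℤ), .check (M.next s r) i), (0, .exit s i r)}
  | .check t i => {(vecAt i (-((1 : ℕ) : ℤ)) ((0 : ℕ) : ℤ), .sink), (0, entry t i.rev)}
  | .accept => {(0, .accept)}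
  | .sink => {(0, .sink)}

variable (M) in
/-- The P-VASS-MDP that simulates `M`. -/
def graph : UnitPVASS M.Control 2 where
  player := {q | ∃ s i, q = .loc s i}
  out := out
  finite_out q := by cases q <;> simp only [out] <;> exact Set.toFinite _
  exists_zero_mem_out q := by cases q <;> simp [out]
  vec_eq_zero := by
    rintro _ ⟨s, i, rfl⟩ e (rfl | ⟨r, rfl⟩) <;> rfl

/-- The moves of a play in which Player 1 makes only truthful announcements, without the loops at
`dec` and `exit`. -/
inductive Honest : M.Control × (Fin 2 → ℕ) → M.Control × (Fin 2 → ℕ) → Prop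
  | dec {s i} {v : Fin 2 → ℕ} (h : M.modulus s ≤ v i) : Honest (.loc s i, v) (.dec s i, v)
  | transfer {s i} {v : Fin 2 → ℕ} (h : M.modulus s ≤ v i) :
    Honest (.dec s i, v)
      (.loc s i, shift v (vecAt i (-(M.modulus s : ℤ)) (M.factor s : ℤ)))
  | exit {s i} {v : Fin 2 → ℕ} {r : Fin (M.modulus s)} (h : v i = r) :
    Honest (.loc s i, v) (.exit s i r, v)
  | check {s i} {v : Fin 2 → ℕ} {r : Fin (M.modulus s)} (h : v i = r) :
    Honest (.exit s i r, v)
      (.check (M.next s r) i, shift v (vecAt i (-((r : ℕ) : ℤ)) (M.offset s r : ℤ)))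
  | pass {t i} {v : Fin 2 → ℕ} (h : v i = 0) : Honest (.check t i, v) (entry t i.rev, v)

theorem reflTransGen_honest_loc (s : M.State) (i : Fin 2) (r k y : ℕ) :
    Relation.ReflTransGen Honest (.loc s i, vecAt i (M.modulus s * k + r) y)
      (.loc s i, vecAt i r (M.factor s * k + y)) := by
  induction k generalizing y with
  | zero => simp only [mul_zero, zero_add]; exact .refl
  | succ k ih =>
    have h : M.modulus s ≤ vecAt i (M.modulus s * (k + 1) + r) y i := by
      rw [vecAt_self, mul_add_one]; omega
    refine .head (.dec h) (.head (.transfer h) ?_)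
    convert! ih (M.factor s + y) using 2
    · rw [shift_vecAt]; congr 1
      · push_cast; rw [mul_add_one]; omega
      · omega
    · ring_nf

theorem Step.reflTransGen_honest {x x' : (M.State ⊕ Bool) × ℕ} (h : M.Step x x') (i : Fin 2) :
    Relation.ReflTransGen Honest (entry x.1 i, vecAt i x.2 0)
      (entry x'.1 i.rev, vecAt i.rev x'.2 0) := by
  obtain ⟨s, k, r, hr⟩ := h
  refine (reflTransGen_honest_loc s i r k 0).trans (.head
    (.exit (r := ⟨r, hr⟩) (vecAt_self _ _ _)) (.head (.check (vecAt_self _ _ _)) (.single ?_)))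
  have hzero : ((r : ℤ) + -(r : ℤ)).toNat = 0 := by simp
  rw [shift_vecAt, vecAt_rev, hzero, add_zero]
  convert! Honest.pass (M := M) (vecAt_self i 0 _) using 3

theorem Eval.reflTransGen_honest {N N' : ℕ} {b : Bool} (h : M.Eval N b N') :
    ∃ v, Relation.ReflTransGen Honest (.loc M.start 0, vecAt 0 N 0)
      ((bif b then .accept else .sink : M.Control), v) := by
  suffices ∀ x x' : (M.State ⊕ Bool) × ℕ, Relation.ReflTransGen M.Step x x' → ∀ i, ∃ i',
      Relation.ReflTransGen Honest (entry x.1 i, vecAt i x.2 0)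
        (entry x'.1 i', vecAt i' x'.2 0) by
    obtain ⟨i', h⟩ := this _ _ h 0
    exact ⟨_, h⟩
  intro x x' h
  induction h with
  | refl => exact fun i => ⟨i, .refl⟩
  | tail _ hs ih =>
    intro i
    obtain ⟨i', h⟩ := ih i
    exact ⟨_, h.trans (hs.reflTransGen_honest i')⟩

section Accept

/-- The choices of Player 1 in honest plays. -/
noncomputable def honestMove (c : Config (Fin (Nat.card M.Control)) 2) :
    Config (Fin (Nat.card M.Control)) 2 :=
  match (Finite.equivFin M.Control).symm c.state with
  | .loc s i =>
    if h : c.val i < M.modulus s then cfg (.exit s i ⟨c.val i, h⟩) c.val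
    else cfg (.dec s i) c.val
  | _ => c

theorem honestMove_cfg_loc (s : M.State) (i : Fin 2) (v : Fin 2 → ℕ) :
    honestMove (cfg (.loc s i) v) =
      if h : v i < M.modulus s then cfg (.exit s i ⟨v i, h⟩) v
      else cfg (.dec s i) v := by
  simp only [honestMove, cfg, Equiv.symm_apply_apply]
  rfl

theorem step_honestMove (c : Config (Fin (Nat.card M.Control)) 2)
    (hc : c.state ∈ M.graph.mdp.Q₁) : M.graph.mdp.Step c (honestMove (M := M) c) := by
  obtain ⟨q, v, rfl⟩ := exists_cfg_eq c
  obtain ⟨s, i, rfl⟩ := M.graph.equivFin_mem_player.1 hc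
  rw [honestMove_cfg_loc]
  split_ifs with h
  · exact step_of_zero_mem_out (G := M.graph) (Set.mem_insert_of_mem _ (Set.mem_range_self _)) v
  · exact step_of_zero_mem_out (G := M.graph) (Set.mem_insert _ _) v

theorem expectNext_cfg_loc (g : Config (Fin (Nat.card M.Control)) 2 → ℝ≥0∞) (s : M.State)
    (i : Fin 2) (v : Fin 2 → ℕ) :
    M.graph.mdp.expectNext M.graph.deadlockFree honestMove g (cfg (.loc s i) v) =
      g (honestMove (cfg (.loc s i) v)) :=
  if_pos (M.graph.equivFin_mem_player.2 ⟨s, i, rfl⟩)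

theorem expectNext_cfg (g : Config (Fin (Nat.card M.Control)) 2 → ℝ≥0∞) {q : M.Control}
    (hq : ∀ s i, q ≠ .loc s i) (v : Fin 2 → ℕ) :
    M.graph.mdp.expectNext M.graph.deadlockFree honestMove g (cfg q v) =
      ∫⁻ y, g y
        ∂(M.graph.mdp.succDist M.graph.deadlockFree (cfg q v)).toMeasure :=
  if_neg fun h =>
    let ⟨s, i, h⟩ := M.graph.equivFin_mem_player.1 h
    hq s i h

variable (M) in
/-- The probability of reaching `accept` when Player 1 moves according to `honestMove`, as a
function of the initial configuration. -/
noncomputable def acceptProb : Config (Fin (Nat.card M.Control)) 2 → ℝ≥0∞ :=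
  ⨆ n, M.graph.mdp.visitProb M.graph.deadlockFree honestMove (Finite.equivFin M.Control .accept) n

theorem visitProb_accept_zero_le_one :
    M.graph.mdp.visitProb M.graph.deadlockFree honestMove (Finite.equivFin M.Control .accept) 0 ≤
      M.graph.mdp.visitProb M.graph.deadlockFree honestMove
        (Finite.equivFin M.Control .accept) 1 := by
  refine Set.indicator_le fun c hc => ?_
  obtain ⟨q, v, rfl⟩ := exists_cfg_eq c
  obtain rfl := cfg_state_eq_iff.1 hc
  have hE : M.graph.enabledOut .accept v = {(0, .accept)} := by
    refine Set.sep_eq_self_iff_mem_true.2 ?_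
    rintro _ rfl
    simp
  rw [VASSMDP.visitProb_succ, expectNext_cfg _ (by simp),
    lintegral_succDist_cfg_singleton _ hE]
  exact (VASSMDP.visitProb_zero_of_state_eq _ _ _ (cfg_state_eq_iff.2 rfl)).ge

theorem expectNext_acceptProb :
    M.graph.mdp.expectNext M.graph.deadlockFree honestMove M.acceptProb = M.acceptProb :=
  VASSMDP.expectNext_iSup_visitProb visitProb_accept_zero_le_one

theorem acceptProb_le_one (c : Config (Fin (Nat.card M.Control)) 2) : M.acceptProb c ≤ 1 := by
  rw [acceptProb, iSup_apply]
  refine iSup_le fun n => ?_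
  rw [← VASSMDP.playMeasure_positional_state_eq (hm := step_honestMove)]
  exact prob_le_one

theorem acceptProb_eq_of_enabledOut_eq_pair {q q' : M.Control} (hq : ∀ s i, q ≠ .loc s i)
    {z : Fin 2 → ℤ} {v : Fin 2 → ℕ} (hE : M.graph.enabledOut q v = {(z, q'), (0, q)})
    (hne : q' ≠ q) :
    M.acceptProb (cfg q v) = M.acceptProb (cfg q' (shift v z)) := by
  have hmean := congrFun M.expectNext_acceptProb (cfg q v)
  rw [expectNext_cfg _ hq, lintegral_succDist_cfg_pair _ hE
    fun h => hne (congrArg Prod.snd h), shift_zero] at hmean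
  have hfinite := fun c => ne_top_of_le_ne_top ENNReal.one_ne_top (M.acceptProb_le_one c)
  have hq := hfinite (cfg q v)
  have hq' := hfinite (cfg q' (shift v z))
  rw [← ENNReal.toReal_eq_toReal_iff' hq hq']
  have hreal := congrArg ENNReal.toReal hmean
  rw [ENNReal.toReal_div, ENNReal.toReal_add hq' hq, ENNReal.toReal_ofNat] at hreal
  linarith

theorem Honest.acceptProb_eq {x y : M.Control × (Fin 2 → ℕ)} (h : Honest x y) :
    M.acceptProb (cfg x.1 x.2) = M.acceptProb (cfg y.1 y.2) := by
  cases h with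
  | dec h =>
    conv_lhs => rw [← expectNext_acceptProb]
    rw [expectNext_cfg_loc, honestMove_cfg_loc, dif_neg (not_lt.2 h)]
  | @exit s i v r h =>
    obtain ⟨r, hr⟩ := r
    obtain rfl : v i = r := h
    conv_lhs => rw [← expectNext_acceptProb]
    rw [expectNext_cfg_loc, honestMove_cfg_loc, dif_pos hr]
  | transfer h =>
    exact acceptProb_eq_of_enabledOut_eq_pair (by simp)
      (enabledOut_eq_pair rfl (add_vecAt_neg_nonneg_iff.2 h)) (by simp)
  | check h =>
    exact acceptProb_eq_of_enabledOut_eq_pair (by simp)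
      (enabledOut_eq_pair rfl (add_vecAt_neg_nonneg_iff.2 h.ge)) (by simp)
  | pass h =>
    conv_lhs => rw [← expectNext_acceptProb]
    rw [expectNext_cfg _ (by simp), lintegral_succDist_cfg_singleton _
      (enabledOut_eq_singleton rfl (add_vecAt_neg_nonneg_iff.not.2 (by simp [h]))),
      shift_zero]

variable (M) in
theorem acceptProb_accept (v : Fin 2 → ℕ) : M.acceptProb (cfg .accept v) = 1 := by
  refine le_antisymm (M.acceptProb_le_one _) ?_
  rw [acceptProb, iSup_apply]
  exact le_iSup_of_le 0 (VASSMDP.visitProb_zero_of_state_eq _ _ _ (cfg_state_eq_iff.2 rfl)).ge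

end Accept

/-- The honest play from `x` reaches `accept`. -/
def Accepting (x : M.Control × (Fin 2 → ℕ)) : Prop :=
  ∃ v, Relation.ReflTransGen Honest x (.accept, v)

theorem Accepting.acceptProb_eq_one {x : M.Control × (Fin 2 → ℕ)} (h : Accepting x) :
    M.acceptProb (cfg x.1 x.2) = 1 := by
  obtain ⟨v, h⟩ := h
  induction h using Relation.ReflTransGen.head_induction_on with
  | refl => exact M.acceptProb_accept v
  | head hxy _ ih => exact hxy.acceptProb_eq.trans ih

theorem Accepting.almostSureRepeatedReach {q : M.Control} {v : Fin 2 → ℕ}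
    (h : Accepting (q, v)) : (M.graph.toPInstance q v .accept).AlmostSureRepeatedReach :=
  ⟨M.graph.mdp.positional honestMove step_honestMove,
    VASSMDP.playMeasure_positional_repeatedReachEvent_eq_one visitProb_accept_zero_le_one
      ((iSup_apply).symm.trans h.acceptProb_eq_one)⟩

section Reject

theorem Accepting.exists_honest {q : M.Control} {v : Fin 2 → ℕ} (h : Accepting (q, v))
    (hq : q ≠ .accept) : ∃ x, Honest (q, v) x ∧ Accepting x := by
  obtain ⟨w, h⟩ := h
  rcases h.cases_head with h | ⟨x, hx, hxw⟩
  exacts [absurd (congrArg Prod.fst h) hq, ⟨x, hx, w, hxw⟩]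

theorem Honest.accepting {x y : M.Control × (Fin 2 → ℕ)} (h : Honest x y) :
    Accepting y → Accepting x := fun ⟨w, hw⟩ => ⟨w, .head h hw⟩

theorem Honest.rightUnique : Relator.RightUnique (Honest (M := M)) := by
  intro x y z hy hz
  cases hy <;> cases hz <;> grind

theorem not_accepting_of_reflTransGen_sink {x : M.Control × (Fin 2 → ℕ)} {v : Fin 2 → ℕ}
    (h : Relation.ReflTransGen Honest x (.sink, v)) : ¬ Accepting x := by
  rintro ⟨w, h'⟩
  rcases Relation.ReflTransGen.total_of_right_unique Honest.rightUnique h h' with h | h <;>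
  · obtain h | ⟨y, hy, -⟩ := h.cases_head
    · simp at h
    · cases hy

theorem Accepting.of_mem_enabledOut {q : M.Control} {v : Fin 2 → ℕ}
    {e : (Fin 2 → ℤ) × M.Control} (he : e ∈ M.graph.enabledOut q v)
    (hq : ∀ t i, q = .check t i → v i = 0) (h : Accepting (e.2, shift v e.1)) :
    Accepting (q, v) := by
  obtain ⟨he, hv⟩ := he
  have accepting_of_loop {q' : M.Control} (he : e = (0, q')) : Accepting (q', v) := by
    subst he
    rwa [shift_zero] at h
  cases q with
  | loc s i =>
    rcases he with he | ⟨r, he⟩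
    · have hdec := accepting_of_loop he
      obtain ⟨_, ⟨⟩, -⟩ := hdec.exists_honest (by simp)
      exact (Honest.dec ‹_›).accepting hdec
    · have hexit := accepting_of_loop he.symm
      obtain ⟨_, ⟨⟩, -⟩ := hexit.exists_honest (by simp)
      exact (Honest.exit ‹_›).accepting hexit
  | dec s i =>
    rcases he with rfl | he
    · exact (Honest.transfer (add_vecAt_neg_nonneg_iff.1 hv)).accepting h
    · exact accepting_of_loop he
  | exit s i r =>
    rcases he with rfl | he
    · have hle : (r : ℕ) ≤ v i := add_vecAt_neg_nonneg_iff.1 hv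
      obtain ⟨_, hcheck, -⟩ := h.exists_honest (by simp)
      have hzero : shift v (vecAt i (-((r : ℕ) : ℤ)) (M.offset s r : ℤ)) i = 0 := by
        cases hcheck; assumption
      rw [shift, vecAt_self] at hzero
      exact (Honest.check (by omega)).accepting h
    · exact accepting_of_loop he
  | check t i =>
    rcases he with rfl | he
    · have hle : 1 ≤ v i := add_vecAt_neg_nonneg_iff.1 hv
      rw [hq t i rfl] at hle
      omega
    · exact (Honest.pass (hq t i rfl)).accepting (accepting_of_loop he)
  | accept => exact accepting_of_loop he
  | sink => exact accepting_of_loop he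

open Classical in
/-- A bound for the probability of reaching `accept` under an arbitrary strategy. -/
noncomputable def value (x : M.Control × (Fin 2 → ℕ)) : ℝ≥0∞ :=
  if x.1 = .sink then 0 else if Accepting x then 1 else 2⁻¹

theorem value_sink (v : Fin 2 → ℕ) : value (M := M) (.sink, v) = 0 := if_pos rfl

theorem value_le_one (x : M.Control × (Fin 2 → ℕ)) : value x ≤ 1 := by
  unfold value
  split_ifs <;> simp

theorem inv_two_le_value {x : M.Control × (Fin 2 → ℕ)} (hx : x.1 ≠ .sink) : 2⁻¹ ≤ value x := by
  rw [value, if_neg hx]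
  split_ifs <;> simp

theorem value_le_inv_two {x : M.Control × (Fin 2 → ℕ)} (hx : ¬ Accepting x) : value x ≤ 2⁻¹ := by
  rw [value, if_neg hx]
  split_ifs <;> simp

theorem Accepting.value_eq_one {x : M.Control × (Fin 2 → ℕ)} (h : Accepting x)
    (hx : x.1 ≠ .sink) : value x = 1 := by
  rw [value, if_neg hx, if_pos h]

theorem value_shift_le {q : M.Control} {v : Fin 2 → ℕ} {e : (Fin 2 → ℤ) × M.Control}
    (he : e ∈ M.graph.enabledOut q v) (hq : ∀ t i, q = .check t i → v i = 0) :
    value (e.2, shift v e.1) ≤ value (q, v) := by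
  by_cases hsink : q = .sink
  · subst hsink
    obtain rfl : e = (0, .sink) := he.1
    exact (value_sink _).trans_le zero_le
  by_cases hacc : Accepting (e.2, shift v e.1)
  · exact (value_le_one _).trans ((hacc.of_mem_enabledOut he hq).value_eq_one hsink).ge
  · exact (value_le_inv_two hacc).trans (inv_two_le_value hsink)

/-- The function `value`, on the configurations of the MDP. -/
noncomputable def cfgValue (c : Config (Fin (Nat.card M.Control)) 2) : ℝ≥0∞ :=
  value ((Finite.equivFin M.Control).symm c.state, c.val)

theorem cfgValue_cfg (q : M.Control) (v : Fin 2 → ℕ) :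
    cfgValue (cfg q v) = value (q, v) := by
  simp [cfgValue, cfg]

theorem lintegral_cfgValue_check_le (t : M.State ⊕ Bool) {i : Fin 2} {v : Fin 2 → ℕ}
    (hv : v i ≠ 0) :
    ∫⁻ y, cfgValue (M := M) y ∂(M.graph.mdp.succDist M.graph.deadlockFree
      (cfg (.check t i) v)).toMeasure ≤ value (.check t i, v) := by
  have hz : vecAt i (-((1 : ℕ) : ℤ)) ((0 : ℕ) : ℤ) ≠ 0 := fun h => by
    simpa [vecAt_self] using congrFun h i
  rw [lintegral_succDist_cfg_pair _
      (enabledOut_eq_pair rfl (add_vecAt_neg_nonneg_iff.2 (Nat.one_le_iff_ne_zero.2 hv)))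
      fun h => hz (congrArg Prod.fst h), cfgValue_cfg, cfgValue_cfg, value_sink, zero_add]
  refine (ENNReal.div_le_div_right (value_le_one _) 2).trans ?_
  rw [one_div]
  exact inv_two_le_value (by simp)

theorem isSuperharmonic_cfgValue :
    M.graph.mdp.IsSuperharmonic M.graph.deadlockFree (cfgValue (M := M)) := by
  have cfgValue_le_of_step {q : M.Control} {v : Fin 2 → ℕ}
      (hq : ∀ t i, q = .check t i → v i = 0) (c' : Config (Fin (Nat.card M.Control)) 2)
      (h : M.graph.mdp.Step (cfg q v) c') :
      cfgValue (M := M) c' ≤ cfgValue (cfg q v) := by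
    obtain ⟨e, he, rfl⟩ := step_cfg_iff.1 h
    rw [cfgValue_cfg, cfgValue_cfg]
    exact value_shift_le he hq
  constructor
  · intro c c' hc h
    obtain ⟨q, v, rfl⟩ := exists_cfg_eq c
    obtain ⟨s, i, rfl⟩ := M.graph.equivFin_mem_player.1 hc
    exact cfgValue_le_of_step (by simp) c' h
  · intro c _
    obtain ⟨q, v, rfl⟩ := exists_cfg_eq c
    by_cases hq : ∀ t i, q = .check t i → v i = 0
    · exact M.graph.mdp.lintegral_succDist_le _ (cfgValue_le_of_step hq)
    · push Not at hq
      obtain ⟨t, i, rfl, hv⟩ := hq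
      rw [cfgValue_cfg]
      exact lintegral_cfgValue_check_le t hv

theorem not_limitSureReach_of_not_accepting {q : M.Control} {v : Fin 2 → ℕ}
    (h : ¬ Accepting (q, v)) : ¬ (M.graph.toPInstance q v .accept).LimitSureReach := by
  refine PInstance.not_limitSureReach_of_prob_le (b := 2⁻¹) (by simp [ENNReal.inv_lt_one])
    fun σ => ?_
  refine (isSuperharmonic_cfgValue.playMeasure_reachEvent_le σ _ fun c hc => ?_).trans
    ((cfgValue_cfg q v).trans_le (value_le_inv_two h))
  obtain ⟨q', w, rfl⟩ := exists_cfg_eq c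
  obtain rfl := cfg_state_eq_iff.1 hc
  have haccept : Accepting (M := M) (.accept, w) := ⟨w, .refl⟩
  rw [cfgValue_cfg, haccept.value_eq_one (by simp)]

end Reject

variable (M) in
/-- The input of the reachability problems that simulates `M` on the number `N`. -/
noncomputable def toPInstance (N : ℕ) : PInstance 2 :=
  M.graph.toPInstance (.loc M.start 0) (vecAt 0 N 0) .accept

variable {N N' : ℕ}

theorem Eval.almostSureRepeatedReach (h : M.Eval N true N') :
    (M.toPInstance N).AlmostSureRepeatedReach :=
  Accepting.almostSureRepeatedReach h.reflTransGen_honest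

theorem Eval.not_limitSureReach (h : M.Eval N false N') : ¬ (M.toPInstance N).LimitSureReach :=
  let ⟨_, hv⟩ := h.reflTransGen_honest
  not_limitSureReach_of_not_accepting (not_accepting_of_reflTransGen_sink hv)

variable (M) in
theorem code_toPInstance (N : ℕ) : (M.toPInstance N).code =
    ((M.toPInstance 0).code.1, (M.toPInstance 0).code.2.1,
      ((M.toPInstance 0).code.2.2.1.1, [N, 0]), (M.toPInstance 0).code.2.2.2) := by
  have hinit : List.ofFn (M.toPInstance N).init.val = [N, 0] := by
    simp [toPInstance, UnitPVASS.toPInstance, UnitPVASS.cfg, vecAt]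
  rw [← hinit]
  rfl

variable (M) in
theorem computable_code_toPInstance : Computable fun n => (M.toPInstance (2 ^ n)).code := by
  have hpow : Computable fun n : ℕ => 2 ^ n :=
    ((Primrec₂.unpaired'.1 Nat.Primrec.pow).comp (.const 2) .id).to_comp
  simp only [M.code_toPInstance (2 ^ _)]
  exact (Computable.const _).pair ((Computable.const _).pair
    (((Computable.const _).pair
      (Computable.list_cons.comp hpow (Computable.const [0]))).pair (Computable.const _)))

end ResidueMachine

theorem not_exists_computable_separation :
    ¬ ∃ d : ℕ → Bool, Computable d ∧
      (∀ n, 1 ∈ (Denumerable.ofNat Nat.Partrec.Code n).eval n → d n = true) ∧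
      ∀ n, 0 ∈ (Denumerable.ofNat Nat.Partrec.Code n).eval n → d n = false := by
  rintro ⟨d, hd, h₁, h₀⟩
  have hg : Computable fun n => bif d n then 0 else 1 :=
    Computable.cond hd (Computable.const 0) (Computable.const 1)
  obtain ⟨c, hc⟩ := Nat.Partrec.Code.exists_code.1 (Partrec.nat_iff.1 hg.partrec)
  have hdiag : c.eval (Encodable.encode c) =
      Part.some (bif d (Encodable.encode c) then 0 else 1) := by
    rw [hc]; rfl
  have h₁ := h₁ (Encodable.encode c)
  have h₀ := h₀ (Encodable.encode c)
  rw [Denumerable.ofNat_encode, hdiag] at h₁ h₀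
  cases h : d (Encodable.encode c) <;> simp [h] at h₁ h₀

theorem not_decidableProblem_of_between {P : PInstance 2 → Prop}
    (h₁ : ∀ I : PInstance 2, I.AlmostSureRepeatedReach → P I)
    (h₂ : ∀ I : PInstance 2, P I → I.LimitSureReach) : ¬ DecidableProblem P := by
  rintro ⟨f, hf, hfP⟩
  have hdiag : Partrec fun n => (Denumerable.ofNat Nat.Partrec.Code n).eval n :=
    Nat.Partrec.Code.eval_part.comp (Computable.ofNat _) Computable.id
  obtain ⟨M, hM⟩ := exists_machine_of_partrec hdiag
  have hfM (n : ℕ) := hfP _ _ (M.toPInstance (2 ^ n)).isCode_code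
  refine not_exists_computable_separation ⟨fun n => f (M.toPInstance (2 ^ n)).code,
    hf.comp M.computable_code_toPInstance, fun n hn => ?_, fun n hn => ?_⟩
  · obtain ⟨_, heval⟩ := hM n 1 hn
    exact (hfM n).2 (h₁ _ heval.almostSureRepeatedReach)
  · obtain ⟨_, heval⟩ := hM n 0 hn
    exact Bool.eq_false_iff.2 ((hfM n).not.2 (heval.not_limitSureReach ∘ h₂ _))

theorem mainTheorem7 :
    ¬ DecidableProblem (d := 2) PInstance.AlmostSureReach ∧
    ¬ DecidableProblem (d := 2) PInstance.LimitSureReach ∧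
    ¬ DecidableProblem (d := 2) PInstance.AlmostSureRepeatedReach ∧
    ¬ DecidableProblem (d := 2) PInstance.LimitSureRepeatedReach :=
  ⟨not_decidableProblem_of_between (fun _ h => h.almostSureReach) fun _ h => h.limitSureReach,
    not_decidableProblem_of_between (fun _ h => h.almostSureReach.limitSureReach) fun _ h => h,
    not_decidableProblem_of_between (fun _ h => h) fun _ h => h.almostSureReach.limitSureReach,
    not_decidableProblem_of_between (fun _ h => h.limitSureRepeatedReach)
      fun _ h => h.limitSureReach⟩
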